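/- **Corollary 1 ($u$-independent case).** Let $r\ge 3$ and let $T_1^1,\dots,T_1^r\in\mathbb C$ be arbitrary. Put $x^0=1$ and $x^a=T_1^a$ for $1\le a\le r$, and define the infinite matrices $\mathcal T=(\mathcal T_{ij})_{i,j\in\mathbb Z}$, $\mathcal E=(\mathcal E_{ij})_{i,j\in\mathbb Z}$ by $$\mathcal T_{ij}=\begin{cases} x^{\frac{j-i}2+1} & i \text{ odd},\ \frac{i-j}2\in\{1,0,\dots,3-r\},\\ -x^{r-1} & i\text{ odd},\ \frac{i-j}2=\frac52-r,\\ -x^{r} & i\text{ odd},\ \frac{i-j}2=\frac32-r,\\ -x^{\frac{i-j}2+2r-3} & i\text{ odd},\ \frac{i-j}2\in\{1-r,-r,\dots,3-2r\},\\ 0&\text{otherwise,}\end{cases}\qquad \mathcal E_{ij}=\begin{cases} 1& i\text{ even},\ i=j,\\ -1& i\text{ even},\ i=j-4,\\ x^{r-1}& i\text{ even},\ i=j-3,\\ x^r& i\text{ even},\ i=j-1,\\ 0&\text{otherwise.}\end{cases}$$ Let $\mathcal T_n(p,q,\pm x^a)$ denote the $n\times n$ submatrix of $\mathcal T$, on consecutive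 rows and consecutive columns, whose $(p,q)$ entry is the entry $\pm x^a$ of $\mathcal T$ (here $x^a$ is treated as a formal symbol; for the entries used below the submatrix does not depend on which occurrence of that symbol is chosen), and similarly for $\mathcal E_n(p,q,x^a)$. Set $T_0^a=1$ for $1\le a\le r$, $T_k^0=1$ for $k\ge 0$, and for $k\ge1$ $$T_k^a=\det\bigl(\mathcal T_{2k-1}(1,1,T_1^a)+\mathcal E_{2k-1}(2,3,T_1^r)\bigr)\quad(1\le a\le r-2),$$ $$T_k^{r-1}=\mathrm{pf}\bigl(\mathcal T_{2k}(2,1,-T_1^{r-1})+\mathcal E_{2k}(1,2,T_1^{r-1})\bigr),\qquad T_k^{r}=(-1)^k\,\mathrm{pf}\bigl(\mathcal T_{2k}(1,2,-T_1^{r})+\mathcal E_{2k}(2,1,T_1^{r})\bigr).$$ Then the two matrices under the Pfaffians are skew-symmetric, for $k=1$ the formulas return the given values $T_1^a$ ($1\le a\le r$), and the $T_k^a$ solve the $D_r$ Kirillov–Reshetikhin equations: for all $k\ge1$, $$(T_k^a)^2-T_{k+1}^aT_{k-1}^a=\begin{cases}T_k^{a-1}T_k^{a+1}&1\le a\le r-3,\\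 T_k^{r-3}T_k^{r-1}T_k^r& a=r-2,\\ T_k^{r-2}& a=r-1,\,r.\end{cases}$$ -/

import Mathlib

/-- The Pfaffian of a `2k × 2k` (skew-symmetric) matrix, over a commutative `ℚ`-algebra:
`pf A = (1 / (2 ^ k * k!)) * ∑ σ, sgn σ * ∏ i, A (σ (2i)) (σ (2i+1))`. -/
noncomputable def pfaffian {R : Type*} [CommRing R] [Algebra ℚ R] {k : ℕ}
    (A : Matrix (Fin (2 * k)) (Fin (2 * k)) R) : R :=
  ((2 : ℚ) ^ k * (k.factorial : ℚ))⁻¹ •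
    ∑ σ : Equiv.Perm (Fin (2 * k)), ((Equiv.Perm.sign σ : ℤ) : R) *
      ∏ i : Fin k, A (σ ⟨2 * (i : ℕ), by have := i.isLt; omega⟩)
        (σ ⟨2 * (i : ℕ) + 1, by have := i.isLt; omega⟩)

/-- The symbols `x^a`: `x^0 = 1` and `x^a = T_1^a` for `1 ≤ a ≤ r`
(only indices `0 ≤ a ≤ r` are ever used). -/
def krX {R : Type*} [CommRing R] (t : ℕ → R) (a : ℤ) : R :=
  if a = 0 then 1 else t a.toNat

/-- The doubly infinite matrix `𝒯`, in the case of no spectral parameter. -/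
def calT {R : Type*} [CommRing R] (r : ℕ) (t : ℕ → R) : Matrix ℤ ℤ R :=
  Matrix.of fun i j =>
    if Odd i then
      if Even (i - j) ∧ 3 - (r : ℤ) ≤ (i - j) / 2 ∧ (i - j) / 2 ≤ 1 then
        krX t ((j - i) / 2 + 1)
      else if i - j = 5 - 2 * (r : ℤ) then -krX t ((r : ℤ) - 1)
      else if i - j = 3 - 2 * (r : ℤ) then -krX t (r : ℤ)
      else if Even (i - j) ∧ 3 - 2 * (r : ℤ) ≤ (i - j) / 2 ∧ (i - j) / 2 ≤ 1 - (r : ℤ) then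
        -krX t ((i - j) / 2 + 2 * (r : ℤ) - 3)
      else 0
    else 0

/-- The doubly infinite matrix `ℰ`, in the case of no spectral parameter. -/
def calE {R : Type*} [CommRing R] (r : ℕ) (t : ℕ → R) : Matrix ℤ ℤ R :=
  Matrix.of fun i j =>
    if Even i then
      if i = j then 1
      else if i = j - 4 then -1
      else if i = j - 3 then krX t ((r : ℤ) - 1)
      else if i = j - 1 then krX t (r : ℤ)
      else 0
    else 0

/-- The `n × n` block of consecutive rows and columns of a doubly infinite matrix `M` whose
`(s, t)` entry (counted from `1`) is the entry of `M` at position `(p, q)`. -/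
def zblock {R : Type*} (M : Matrix ℤ ℤ R) (n : ℕ) (s t p q : ℤ) : Matrix (Fin n) (Fin n) R :=
  Matrix.of fun i j => M (p + ((i : ℕ) + 1 - s)) (q + ((j : ℕ) + 1 - t))

/-! Each of the signed symbols `+x^a` (`1 ≤ a ≤ r - 2`), `-x^(r-1)`, `-x^r` occurs exactly once in
every odd row of `𝒯`, each of `+x^(r-1)`, `+x^r` exactly once in every even row of `ℰ`, and a
simultaneous translation of rows and columns by an even number changes neither matrix; so the block
placed at a labelled entry does not depend on which occurrence is chosen.  The following facts record the occurrences used below. -/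

theorem calT_shift {R : Type*} [CommRing R] (r : ℕ) (t : ℕ → R) (i j : ℤ) :
    calT r t (i + 2) (j + 2) = calT r t i j := by
  have h : Odd (i + 2) ↔ Odd i := by simp only [Int.odd_iff]; omega
  simp only [calT, Matrix.of_apply, add_sub_add_right_eq_sub, h]

theorem calE_shift {R : Type*} [CommRing R] (r : ℕ) (t : ℕ → R) (i j : ℤ) :
    calE r t (i + 2) (j + 2) = calE r t i j := by
  have h : Even (i + 2) ↔ Even i := by simp only [Int.even_iff]; omega
  have h1 : i + 2 = j + 2 ↔ i = j := by omega
  have h2 : i + 2 = j + 2 - 4 ↔ i = j - 4 := by omega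
  have h3 : i + 2 = j + 2 - 3 ↔ i = j - 3 := by omega
  have h4 : i + 2 = j + 2 - 1 ↔ i = j - 1 := by omega
  simp only [calE, Matrix.of_apply, h, h1, h2, h3, h4]

theorem calT_entry {R : Type*} [CommRing R] (r : ℕ) (t : ℕ → R) (a : ℕ) (ha : 1 ≤ a)
    (har : a + 2 ≤ r) : calT r t 1 (2 * a - 1) = t a := by
  have h1 : Even ((1 : ℤ) - (2 * a - 1)) := by simp only [Int.even_iff]; omega
  have h2 : 3 - (r : ℤ) ≤ (1 - (2 * (a : ℤ) - 1)) / 2 := by omega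
  have h3 : (1 - (2 * (a : ℤ) - 1)) / 2 ≤ 1 := by omega
  have h4 : (2 * (a : ℤ) - 1 - 1) / 2 + 1 = a := by omega
  have h5 : (a : ℤ) ≠ 0 := by omega
  have h0 : Odd (1 : ℤ) := odd_one
  rw [calT, Matrix.of_apply, if_pos h0, if_pos ⟨h1, h2, h3⟩, krX, h4, if_neg h5,
    Int.toNat_natCast]

theorem calT_entry_pred {R : Type*} [CommRing R] (r : ℕ) (hr : 3 ≤ r) (t : ℕ → R) :
    calT r t 1 (2 * r - 4) = -t (r - 1) := by
  have h1 : ¬ Even ((1 : ℤ) - (2 * r - 4)) := by simp only [Int.even_iff]; omega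
  have h2 : (1 : ℤ) - (2 * r - 4) = 5 - 2 * r := by ring
  have h4 : (r : ℤ) - 1 ≠ 0 := by omega
  have h5 : ((r : ℤ) - 1).toNat = r - 1 := by omega
  rw [h2] at h1
  simp [calT, krX, h1, h2, h4, h5]

theorem calT_entry_last {R : Type*} [CommRing R] (r : ℕ) (hr : 3 ≤ r) (t : ℕ → R) :
    calT r t 1 (2 * r - 2) = -t r := by
  have h1 : ¬ Even ((1 : ℤ) - (2 * r - 2)) := by simp only [Int.even_iff]; omega
  have h2 : (1 : ℤ) - (2 * r - 2) = 3 - 2 * r := by ring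
  have h4 : (r : ℤ) ≠ 0 := by omega
  rw [h2] at h1
  simp [calT, krX, h1, h2]
  intro h; omega

theorem calE_entry_pred {R : Type*} [CommRing R] (r : ℕ) (hr : 3 ≤ r) (t : ℕ → R) :
    calE r t 0 3 = t (r - 1) := by
  have h4 : (r : ℤ) - 1 ≠ 0 := by omega
  have h5 : ((r : ℤ) - 1).toNat = r - 1 := by omega
  simp [calE, krX, h4, h5]

theorem calE_entry_last {R : Type*} [CommRing R] (r : ℕ) (hr : 3 ≤ r) (t : ℕ → R) :
    calE r t 0 1 = t r := by
  have h4 : r ≠ 0 := by omega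
  simp [calE, krX, h4]

/-- `𝒯_{2k-1}(1, 1, T_1^a) + ℰ_{2k-1}(2, 3, T_1^r)`, for `1 ≤ a ≤ r - 2`. -/
def krMatrix {R : Type*} [CommRing R] (r : ℕ) (t : ℕ → R) (k a : ℕ) :
    Matrix (Fin (2 * k - 1)) (Fin (2 * k - 1)) R :=
  zblock (calT r t) (2 * k - 1) 1 1 1 (2 * a - 1) + zblock (calE r t) (2 * k - 1) 2 3 0 1

/-- `𝒯_{2k}(2, 1, -T_1^(r-1)) + ℰ_{2k}(1, 2, T_1^(r-1))`. -/
def krMatrixPred {R : Type*} [CommRing R] (r : ℕ) (t : ℕ → R) (k : ℕ) :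
    Matrix (Fin (2 * k)) (Fin (2 * k)) R :=
  zblock (calT r t) (2 * k) 2 1 1 (2 * r - 4) + zblock (calE r t) (2 * k) 1 2 0 3

/-- `𝒯_{2k}(1, 2, -T_1^r) + ℰ_{2k}(2, 1, T_1^r)`. -/
def krMatrixLast {R : Type*} [CommRing R] (r : ℕ) (t : ℕ → R) (k : ℕ) :
    Matrix (Fin (2 * k)) (Fin (2 * k)) R :=
  zblock (calT r t) (2 * k) 1 2 1 (2 * r - 2) + zblock (calE r t) (2 * k) 2 1 0 1

/-- The family `T_k^a` (`k ≥ 0`, `0 ≤ a ≤ r`) built from `t a = T_1^a`, `1 ≤ a ≤ r`: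
the determinant and Pfaffian formulas for `k ≥ 1`, `1 ≤ a ≤ r`, and the boundary values
`T_0^a = T_k^0 = 1`. -/
noncomputable def krT {R : Type*} [CommRing R] [Algebra ℚ R] (r : ℕ) (t : ℕ → R) (k a : ℕ) : R :=
  if k = 0 ∨ a = 0 then 1
  else if a ≤ r - 2 then (krMatrix r t k a).det
  else if a = r - 1 then pfaffian (krMatrixPred r t k)
  else (-1) ^ k * pfaffian (krMatrixLast r t k)

/-- `T k a = T_k^a` solves the `D_r` Kirillov–Reshetikhin equations, with the boundary values
`T_0^a = T_k^0 = 1`. -/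
def IsKRSolution {R : Type*} [CommRing R] (r : ℕ) (T : ℕ → ℕ → R) : Prop :=
  (∀ a, 1 ≤ a → a ≤ r → T 0 a = 1) ∧ (∀ k, T k 0 = 1) ∧
  ∀ k, 1 ≤ k →
    (∀ a, 1 ≤ a → a + 3 ≤ r →
      T k a ^ 2 - T (k + 1) a * T (k - 1) a = T k (a - 1) * T k (a + 1)) ∧
    T k (r - 2) ^ 2 - T (k + 1) (r - 2) * T (k - 1) (r - 2)
      = T k (r - 3) * T k (r - 1) * T k r ∧
    T k (r - 1) ^ 2 - T (k + 1) (r - 1) * T (k - 1) (r - 1) = T k (r - 2) ∧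
    T k r ^ 2 - T (k + 1) r * T (k - 1) r = T k (r - 2)

/-!
The solution is identified with families of minors for which the equations are classical identities.

Write `u = x^(r-1)` and `v = x^r`. All matrices in the formulas are blocks of the doubly infinite
matrices `krFull r t a`, which are invariant under the translation by `(2, 2)`. For `a = r - 2` and after
displacing the columns by two it is skew-symmetric (`krSkew`); `T_k^(r-1)` is the Pfaffian of its
principal block on `0, …, 2k - 1`, and `T_k^r` is `(-1)^k` times the one on `1, …, 2k`.

The even rows of `krFull` are sparse: their even-even block is upper unitriangular, with symbol
`1 - z^2`. Eliminating it leaves on the odd indices a Toeplitz matrix, and since the elimination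
only reaches forward, truncation does no harm. Hence `T_k^a = det (h (a + j - i))` of size `k`, where
`h = krSymbol` does not depend on `a`; the same elimination gives `det (h (r - 1 + j - i))` as the
minor of `krSkew` with rows `1, …, 2k` and columns `0, …, 2k - 1`, up to `(-1)^k`.

Three identities then give the equations.
* The Desnanot–Jacobi identity for Toeplitz determinants (`toeplitzDet_desnanot_jacobi`) is the
  equation for `a ≤ r - 2`, with `det (h (r - 1 + j - i))` in the role of `T_k^(r-1) T_k^r`.
* For a skew-symmetric matrix the product of the Pfaffians of two principal blocks of even size
  that differ by a translation by one is a minor (`leadingPf_windowAt_mul`); this is that product formula.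
* `Pf(I,a,b) Pf(I,c,d) - Pf(I) Pf(I,a,b,c,d)` is the minor with rows `I, a, b` and columns
  `I, c, d` (`leadingPf_plucker`). For consecutive blocks this is the equation for `a = r - 1` and
  `a = r`, the minor being `T_k^(r-2)`.

Each of the three identities is proved by induction on `|I|` over a field, splitting off a
`1 × 1` or `2 × 2` pivot by a Schur complement. This requires nonvanishing leading minors or
Pfaffians, which is arranged by joining the given matrix to a nondegenerate one by a line over the
polynomial ring and specialising at the end. Behind the elimination step for Pfaffians are the
congruence rule (`pfaffian_congruence`) and the factorisation for a decoupled first pair of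
coordinates (`pfaffian_decouple`).
-/

/-! ### Pfaffians: congruence and decoupling -/

open Equiv in
theorem pfaffian_submatrix_perm {R : Type*} [CommRing R] [Algebra ℚ R] {k : ℕ}
    (A : Matrix (Fin (2 * k)) (Fin (2 * k)) R) (σ : Equiv.Perm (Fin (2 * k))) :
    pfaffian (A.submatrix σ σ) = ((Equiv.Perm.sign σ : ℤ) : R) * pfaffian A := by
  unfold pfaffian
  rw [mul_smul_comm]
  congr 1
  rw [Finset.mul_sum]
  refine Fintype.sum_equiv (Equiv.mulLeft σ) _ _ fun τ => ?_
  have h : ((Equiv.Perm.sign σ : ℤ) : R) * ((Equiv.Perm.sign σ : ℤ) : R) = 1 := by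
    rw [← Int.cast_mul, Int.units_coe_mul_self, Int.cast_one]
  simp only [Equiv.coe_mulLeft, Equiv.Perm.sign_mul, Units.val_mul, Int.cast_mul,
    Equiv.Perm.mul_apply, Matrix.submatrix_apply]
  rw [← mul_assoc, ← mul_assoc, h, one_mul]

theorem map_pfaffian {R S : Type*} [CommRing R] [Algebra ℚ R] [CommRing S] [Algebra ℚ S] {k : ℕ}
    (φ : R →+* S) (A : Matrix (Fin (2 * k)) (Fin (2 * k)) R) :
    φ (pfaffian A) = pfaffian (A.map φ) := by
  unfold pfaffian
  rw [map_rat_smul φ]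
  simp [map_sum, map_prod]

/-- The coordinate list underlying a choice of one ordered pair for each of the `k` slots. -/
def pairList {α : Type*} {k : ℕ} (g : Fin k → α × α) (p : Fin (2 * k)) : α :=
  if (p : ℕ) % 2 = 0 then (g ⟨p / 2, by omega⟩).1 else (g ⟨p / 2, by omega⟩).2

theorem pairList_even {α : Type*} {k : ℕ} (g : Fin k → α × α) (i : Fin k) (h) :
    pairList g ⟨2 * (i : ℕ), h⟩ = (g i).1 := by
  simp [pairList]

theorem pairList_odd {α : Type*} {k : ℕ} (g : Fin k → α × α) (i : Fin k) (h) :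
    pairList g ⟨2 * (i : ℕ) + 1, h⟩ = (g i).2 := by
  have h1 : (2 * (i : ℕ) + 1) % 2 = 1 := by omega
  have h2 : (2 * (i : ℕ) + 1) / 2 = i := by omega
  simp [pairList, h1, h2]

theorem prod_even_odd {R : Type*} [CommMonoid R] {k : ℕ} (f : Fin (2 * k) → R) :
    ∏ p, f p = ∏ i : Fin k, f ⟨2 * (i : ℕ), by omega⟩ * f ⟨2 * (i : ℕ) + 1, by omega⟩ := by
  induction k with
  | zero => simp
  | succ k ih =>
    rw [Fin.prod_univ_castSucc (n := k)]
    erw [Fin.prod_univ_castSucc (n := 2 * k + 1), Fin.prod_univ_castSucc (n := 2 * k)]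
    rw [ih, mul_assoc]
    rfl

/-- The signed sum for `B A Bᵀ` depends on `B` only through the minors on the chosen columns. -/
theorem pfaffian_sum_congruence {R : Type*} [CommRing R] {k : ℕ}
    (A B : Matrix (Fin (2 * k)) (Fin (2 * k)) R) :
    ∑ σ : Equiv.Perm (Fin (2 * k)), ((Equiv.Perm.sign σ : ℤ) : R) *
      ∏ i : Fin k, (B * A * B.transpose) (σ ⟨2 * (i : ℕ), by omega⟩)
        (σ ⟨2 * (i : ℕ) + 1, by omega⟩)
    = ∑ g : Fin k → Fin (2 * k) × Fin (2 * k), (∏ i, A (g i).1 (g i).2) *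
        (B.submatrix id (pairList g)).det := by
  have h : ∀ x y, (B * A * B.transpose) x y
      = ∑ q : Fin (2 * k) × Fin (2 * k), A q.1 q.2 * (B x q.1 * B y q.2) := by
    intro x y
    simp only [Matrix.mul_apply, Finset.sum_mul, Matrix.transpose_apply, Fintype.sum_prod_type]
    rw [Finset.sum_comm]
    refine Finset.sum_congr rfl fun a _ => Finset.sum_congr rfl fun b _ => by ring
  simp only [h, Finset.prod_univ_sum, Fintype.piFinset_univ, Finset.mul_sum, Matrix.det_apply']
  rw [Finset.sum_comm]
  refine Finset.sum_congr rfl fun g _ => Finset.sum_congr rfl fun σ _ => ?_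
  rw [Finset.prod_mul_distrib, prod_even_odd]
  simp only [Matrix.submatrix_apply, pairList_even, pairList_odd, id]
  ring

/-- Congruence multiplies the Pfaffian by the determinant. -/
theorem pfaffian_congruence {R : Type*} [CommRing R] [Algebra ℚ R] {k : ℕ}
    (A B : Matrix (Fin (2 * k)) (Fin (2 * k)) R) :
    pfaffian (B * A * B.transpose) = B.det * pfaffian A := by
  -- The case `B = 1` of the same expansion is the sum for `A` itself.
  have h1 := pfaffian_sum_congruence A B
  have h2 := pfaffian_sum_congruence A 1
  have h3 : ∀ g : Fin k → Fin (2 * k) × Fin (2 * k), (B.submatrix id (pairList g)).det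
      = B.det * ((1 : Matrix _ _ R).submatrix id (pairList g)).det := by
    intro g
    rw [← Matrix.det_mul]
    congr 1
    ext i j
    simp [Matrix.mul_apply, Matrix.one_apply]
  simp only [Matrix.transpose_one, mul_one, one_mul] at h2
  unfold pfaffian
  rw [h1, h2, mul_smul_comm, Finset.mul_sum]
  congr 1
  refine Finset.sum_congr rfl fun g _ => ?_
  rw [h3]
  ring

/-- The summand of the Pfaffian. -/
def pfTerm {R : Type*} [CommRing R] {k : ℕ} (A : Matrix (Fin (2 * k)) (Fin (2 * k)) R)
    (σ : Equiv.Perm (Fin (2 * k))) : R :=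
  ((Equiv.Perm.sign σ : ℤ) : R) * ∏ i : Fin k, A (σ ⟨2 * (i : ℕ), by omega⟩)
        (σ ⟨2 * (i : ℕ) + 1, by omega⟩)

theorem Fin.coe_swap {n : ℕ} (a b x : Fin n) : ((Equiv.swap a b x : Fin n) : ℕ) =
    if (x : ℕ) = a then (b : ℕ) else if (x : ℕ) = b then (a : ℕ) else x := by
  rw [Equiv.swap_apply_def]
  simp only [Fin.ext_iff]
  split_ifs <;> rfl

/-- The permutation of positions exchanging the first slot with slot `i`. -/
def slotSwap {k : ℕ} (i : Fin (k + 1)) : Equiv.Perm (Fin (2 * (k + 1))) :=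
  Equiv.swap ⟨0, by omega⟩ ⟨2 * (i : ℕ), by omega⟩ *
    Equiv.swap ⟨1, by omega⟩ ⟨2 * (i : ℕ) + 1, by omega⟩

theorem coe_slotSwap {k : ℕ} (i : Fin (k + 1)) (p : Fin (2 * (k + 1))) :
    ((slotSwap i p : Fin (2 * (k + 1))) : ℕ) = if (p : ℕ) = 0 then 2 * (i : ℕ) else
      if (p : ℕ) = 1 then 2 * (i : ℕ) + 1 else if (p : ℕ) = 2 * i then 0 else
      if (p : ℕ) = 2 * i + 1 then 1 else p := by
  simp only [slotSwap, Equiv.Perm.mul_apply, Fin.coe_swap]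
  grind

theorem sign_slotSwap {k : ℕ} (i : Fin (k + 1)) : Equiv.Perm.sign (slotSwap i) = 1 := by
  by_cases hi : i = 0
  · subst hi
    convert Equiv.Perm.sign_one
    ext p
    rw [coe_slotSwap]
    simp only [Fin.val_zero, Equiv.Perm.one_apply]
    grind
  · have hi' : (i : ℕ) ≠ 0 := fun h => hi (Fin.ext h)
    rw [slotSwap, Equiv.Perm.sign_mul, Equiv.Perm.sign_swap, Equiv.Perm.sign_swap]
    · simp
    · simp only [ne_eq, Fin.mk.injEq]; omega
    · simp only [ne_eq, Fin.mk.injEq]; omega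

/-- Exchanging the first slot with another one does not change the summand. -/
theorem pfTerm_mul_slotSwap {R : Type*} [CommRing R] {k : ℕ}
    (A : Matrix (Fin (2 * (k + 1))) (Fin (2 * (k + 1))) R) (σ : Equiv.Perm (Fin (2 * (k + 1))))
    (i : Fin (k + 1)) : pfTerm A (σ * slotSwap i) = pfTerm A σ := by
  unfold pfTerm
  rw [Equiv.Perm.sign_mul, sign_slotSwap, mul_one]
  congr 1
  refine Fintype.prod_equiv (Equiv.swap 0 i) _ _ fun j => ?_
  have h0 : slotSwap i ⟨2 * (j : ℕ), by omega⟩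
      = ⟨2 * ((Equiv.swap 0 i j : Fin (k + 1)) : ℕ), by omega⟩ := by
    ext
    simp only [coe_slotSwap, Fin.coe_swap, Fin.val_zero]
    grind
  have h1 : slotSwap i ⟨2 * (j : ℕ) + 1, by omega⟩
      = ⟨2 * ((Equiv.swap 0 i j : Fin (k + 1)) : ℕ) + 1, by omega⟩ := by
    ext
    simp only [coe_slotSwap, Fin.coe_swap, Fin.val_zero]
    grind
  rw [Equiv.Perm.mul_apply, Equiv.Perm.mul_apply, h0, h1]

open Equiv in
/-- For a skew-symmetric matrix, exchanging the two entries of the first slot does not change the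
summand. -/
theorem pfTerm_mul_swap_zero_one {R : Type*} [CommRing R] {k : ℕ}
    (A : Matrix (Fin (2 * (k + 1))) (Fin (2 * (k + 1))) R) (hA : ∀ i j, A i j = -A j i)
    (σ : Equiv.Perm (Fin (2 * (k + 1)))) :
    pfTerm A (σ * swap ⟨0, by omega⟩ ⟨1, by omega⟩) = pfTerm A σ := by
  unfold pfTerm
  rw [Fin.prod_univ_succ, Fin.prod_univ_succ, Perm.sign_mul, Perm.sign_swap (by simp)]
  have h : ∀ (m : ℕ) (hm : m < 2 * (k + 1)), 2 ≤ m →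
      (swap (⟨0, by omega⟩ : Fin (2 * (k + 1))) ⟨1, by omega⟩) ⟨m, hm⟩ = ⟨m, hm⟩ := by
    intro m hm h2
    apply swap_apply_of_ne_of_ne <;> simp only [ne_eq, Fin.mk.injEq] <;> omega
  have h0 : (swap (⟨0, by omega⟩ : Fin (2 * (k + 1))) ⟨1, by omega⟩)
      ⟨2 * ((0 : Fin (k + 1)) : ℕ), by simp⟩ = ⟨1, by omega⟩ := by simp
  have h1 : (swap (⟨0, by omega⟩ : Fin (2 * (k + 1))) ⟨1, by omega⟩)
      ⟨2 * ((0 : Fin (k + 1)) : ℕ) + 1, by simp; omega⟩ = ⟨0, by omega⟩ := by simp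
  rw [Perm.mul_apply, Perm.mul_apply, h0, h1, hA]
  have h2 : ∏ i : Fin k, A ((σ * swap (⟨0, by omega⟩ : Fin (2 * (k + 1))) ⟨1, by omega⟩)
          ⟨2 * (i.succ : ℕ), by omega⟩)
        ((σ * swap (⟨0, by omega⟩ : Fin (2 * (k + 1))) ⟨1, by omega⟩)
          ⟨2 * (i.succ : ℕ) + 1, by omega⟩)
      = ∏ i : Fin k, A (σ ⟨2 * (i.succ : ℕ), by omega⟩) (σ ⟨2 * (i.succ : ℕ) + 1, by omega⟩) := by
    refine Finset.prod_congr rfl fun i _ => ?_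
    rw [Perm.mul_apply, Perm.mul_apply, h _ _ (by rw [Fin.val_succ]; omega),
      h _ _ (by rw [Fin.val_succ]; omega)]
  rw [h2]
  simp

open Equiv in
/-- The symmetries of the summand act transitively on the positions. -/
theorem exists_pfTerm_invariant {R : Type*} [CommRing R] {k : ℕ}
    (A : Matrix (Fin (2 * (k + 1))) (Fin (2 * (k + 1))) R) (hA : ∀ i j, A i j = -A j i)
    (p : Fin (2 * (k + 1))) :
    ∃ ρ : Equiv.Perm (Fin (2 * (k + 1))), ρ ⟨0, by omega⟩ = p ∧
      ∀ σ, pfTerm A (σ * ρ) = pfTerm A σ := by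
  obtain ⟨p, hp⟩ := p
  rcases Nat.mod_two_eq_zero_or_one p with h | h
  · refine ⟨slotSwap ⟨p / 2, by omega⟩, ?_, fun σ => pfTerm_mul_slotSwap A σ _⟩
    ext
    rw [coe_slotSwap, if_pos rfl]
    simp only []
    omega
  · refine ⟨slotSwap ⟨p / 2, by omega⟩ * swap ⟨0, by omega⟩ ⟨1, by omega⟩, ?_, fun σ => ?_⟩
    · ext
      rw [Perm.mul_apply, swap_apply_left, coe_slotSwap, if_neg one_ne_zero, if_pos rfl]
      simp only []
      omega
    · rw [← mul_assoc, pfTerm_mul_swap_zero_one A hA, pfTerm_mul_slotSwap]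

open Equiv in
/-- By invariance under the slot symmetries, the summands can be normalised so that the value `0`
sits in position `0`. -/
theorem sum_pfTerm {R : Type*} [CommRing R] {k : ℕ}
    (A : Matrix (Fin (2 * (k + 1))) (Fin (2 * (k + 1))) R) (hA : ∀ i j, A i j = -A j i) :
    ∑ σ, pfTerm A σ = (2 * (k + 1) : ℕ) *
      ∑ σ : Perm (Fin (2 * (k + 1))),
        if σ ⟨0, by omega⟩ = ⟨0, by omega⟩ then pfTerm A σ else 0 := by
  have h1 : ∀ σ : Perm (Fin (2 * (k + 1))), pfTerm A σ =
      ∑ p, if σ p = ⟨0, by omega⟩ then pfTerm A σ else 0 := by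
    intro σ
    rw [Finset.sum_eq_single (σ.symm ⟨0, by omega⟩)]
    · simp
    · intro p _ hp
      rw [if_neg]
      intro h
      exact hp (by rw [← h]; simp)
    · simp
  rw [Finset.sum_congr rfl fun σ _ => h1 σ, Finset.sum_comm]
  have h2 : ∀ p, (∑ σ : Perm (Fin (2 * (k + 1))), if σ p = ⟨0, by omega⟩ then pfTerm A σ else 0)
      = ∑ σ : Perm (Fin (2 * (k + 1))),
        if σ ⟨0, by omega⟩ = ⟨0, by omega⟩ then pfTerm A σ else 0 := by
    intro p
    obtain ⟨ρ, hρ, hinv⟩ := exists_pfTerm_invariant A hA p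
    rw [← Equiv.sum_comp (Equiv.mulRight ρ)
      (fun σ => if σ ⟨0, by omega⟩ = ⟨0, by omega⟩ then pfTerm A σ else 0)]
    refine Finset.sum_congr rfl fun σ _ => ?_
    simp only [Equiv.coe_mulRight, hinv, Perm.mul_apply, hρ]
  rw [Finset.sum_congr rfl fun p _ => h2 p, Finset.sum_const, Finset.card_univ, Fintype.card_fin,
    nsmul_eq_mul]

open Equiv in
/-- If the first two coordinates decouple from the others, the Pfaffian factors. -/
theorem pfaffian_decouple {R : Type*} [CommRing R] [Algebra ℚ R] {k : ℕ}
    (A : Matrix (Fin (2 * (k + 1))) (Fin (2 * (k + 1))) R) (hA : ∀ i j, A i j = -A j i)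
    (h0 : ∀ j : Fin (2 * (k + 1)), 2 ≤ (j : ℕ) → A ⟨0, by omega⟩ j = 0) :
    pfaffian A = A ⟨0, by omega⟩ ⟨1, by omega⟩ *
      pfaffian (Matrix.of fun i j : Fin (2 * k) => A ⟨i + 2, by omega⟩ ⟨j + 2, by omega⟩) := by
  have hsum : (∑ σ : Perm (Fin (2 * (k + 1))),
      if σ ⟨0, by omega⟩ = ⟨0, by omega⟩ then pfTerm A σ else 0)
      = A ⟨0, by omega⟩ ⟨1, by omega⟩ * ∑ τ, pfTerm
        (Matrix.of fun i j : Fin (2 * k) => A ⟨i + 2, by omega⟩ ⟨j + 2, by omega⟩) τ := by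
    -- Fixing the values at the first two positions leaves a permutation of the other coordinates.
    have e1 := Equiv.sum_comp (Perm.decomposeFin (n := 2 * k + 1)).symm
      (fun σ : Perm (Fin (2 * (k + 1))) =>
        if σ ⟨0, by omega⟩ = ⟨0, by omega⟩ then pfTerm A σ else 0)
    refine e1.symm.trans ?_
    rw [Fintype.sum_prod_type, Finset.sum_eq_single 0]
    rotate_left
    · intro p _ hp
      refine Finset.sum_eq_zero fun τ _ => if_neg ?_
      have : (Perm.decomposeFin.symm (p, τ)) 0 = p := Perm.decomposeFin_symm_apply_zero p τ
      exact fun h => hp (this.symm.trans h)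
    · simp
    rw [← Equiv.sum_comp (Perm.decomposeFin (n := 2 * k)).symm, Fintype.sum_prod_type,
      Finset.sum_eq_single 0]
    rotate_left
    · intro p _ hp
      refine Finset.sum_eq_zero fun τ _ => ?_
      refine (if_pos (Perm.decomposeFin_symm_apply_zero _ _)).trans ?_
      unfold pfTerm
      rw [Fin.prod_univ_succ]
      have e2 : (Perm.decomposeFin.symm ((0 : Fin (2 * k + 2)), Perm.decomposeFin.symm (p, τ)))
          (0 : Fin (2 * k + 1)).succ = p.succ := by
        rw [Perm.decomposeFin_symm_apply_succ, Perm.decomposeFin_symm_apply_zero, swap_self,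
          refl_apply]
      have e3 : (Perm.decomposeFin.symm ((0 : Fin (2 * k + 2)), Perm.decomposeFin.symm (p, τ)))
          0 = 0 := Perm.decomposeFin_symm_apply_zero _ _
      have e4 : A ((Perm.decomposeFin.symm ((0 : Fin (2 * k + 2)), Perm.decomposeFin.symm (p, τ)))
          0) ((Perm.decomposeFin.symm ((0 : Fin (2 * k + 2)), Perm.decomposeFin.symm (p, τ)))
          (0 : Fin (2 * k + 1)).succ) = 0 := by
        rw [e2, e3]
        refine h0 _ ?_
        have : (p : ℕ) ≠ 0 := fun h => hp (Fin.ext h)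
        simp only [Fin.val_succ]
        omega
      refine mul_eq_zero_of_right _ (mul_eq_zero_of_left e4 _)
    · simp
    rw [Finset.mul_sum]
    refine Finset.sum_congr rfl fun τ _ => ?_
    refine (if_pos (Perm.decomposeFin_symm_apply_zero _ _)).trans ?_
    unfold pfTerm
    rw [Fin.prod_univ_succ, Perm.decomposeFin.symm_sign, Perm.decomposeFin.symm_sign, if_pos rfl,
      if_pos rfl, one_mul, one_mul]
    have e5 : ∀ i : Fin (2 * k), (Perm.decomposeFin.symm ((0 : Fin (2 * k + 2)),
        Perm.decomposeFin.symm ((0 : Fin (2 * k + 1)), τ))) i.succ.succ = (τ i).succ.succ := by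
      intro i
      rw [Perm.decomposeFin_symm_apply_succ, Perm.decomposeFin_symm_apply_succ, swap_self,
          refl_apply, swap_self, refl_apply]
    have e2 : (Perm.decomposeFin.symm ((0 : Fin (2 * k + 2)),
        Perm.decomposeFin.symm ((0 : Fin (2 * k + 1)), τ))) (0 : Fin (2 * k + 1)).succ = 1 := by
      rw [Perm.decomposeFin_symm_apply_succ, Perm.decomposeFin_symm_apply_zero, swap_self,
        refl_apply]
      rfl
    have e3 : (Perm.decomposeFin.symm ((0 : Fin (2 * k + 2)),
        Perm.decomposeFin.symm ((0 : Fin (2 * k + 1)), τ))) 0 = 0 :=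
      Perm.decomposeFin_symm_apply_zero _ _
    have e4 : A ((Perm.decomposeFin.symm ((0 : Fin (2 * k + 2)),
        Perm.decomposeFin.symm ((0 : Fin (2 * k + 1)), τ))) 0)
        ((Perm.decomposeFin.symm ((0 : Fin (2 * k + 2)),
        Perm.decomposeFin.symm ((0 : Fin (2 * k + 1)), τ))) (0 : Fin (2 * k + 1)).succ)
        = A ⟨0, by omega⟩ ⟨1, by omega⟩ := by
      rw [e2, e3]
      rfl
    rw [mul_left_comm]
    refine congrArg₂ _ e4 (congrArg _ (Finset.prod_congr rfl fun i _ => ?_))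
    exact congrArg₂ A (e5 ⟨2 * i, by omega⟩) (e5 ⟨2 * i + 1, by omega⟩)
  have h := sum_pfTerm A hA
  rw [hsum] at h
  have hL : pfaffian A = ((2 : ℚ) ^ (k + 1) * ((k + 1).factorial : ℚ))⁻¹ • ∑ σ, pfTerm A σ := rfl
  have hR : ∀ B : Matrix (Fin (2 * k)) (Fin (2 * k)) R,
    pfaffian B = ((2 : ℚ) ^ k * (k.factorial : ℚ))⁻¹ • ∑ σ, pfTerm B σ := fun B => rfl
  rw [hL, hR, h, mul_smul_comm]
  have h3 : ∀ x : R, ((2 * (k + 1) : ℕ) : R) * x = ((2 * (k + 1) : ℕ) : ℚ) • x := by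
    intro x
    rw [Algebra.smul_def, map_natCast]
  rw [h3, smul_smul]
  congr 1
  rw [Nat.factorial_succ]
  have : (k.factorial : ℚ) ≠ 0 := by positivity
  push_cast
  field_simp
  ring

/-! ### Leading minors, leading Pfaffians and Schur complements -/

/-- The determinant of the leading `n × n` block of an infinite matrix. -/
def leadingMinor {R : Type*} [CommRing R] (n : ℕ) (M : ℕ → ℕ → R) : R :=
  (Matrix.of fun i j : Fin n => M i j).det

/-- The Pfaffian of the leading `2k × 2k` block of an infinite matrix. -/
noncomputable def leadingPf {R : Type*} [CommRing R] [Algebra ℚ R] (k : ℕ) (A : ℕ → ℕ → R) : R :=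
  pfaffian (Matrix.of fun i j : Fin (2 * k) => A i j)

theorem leadingMinor_congr {R : Type*} [CommRing R] {n : ℕ} {M N : ℕ → ℕ → R}
    (h : ∀ i < n, ∀ j < n, M i j = N i j) : leadingMinor n M = leadingMinor n N := by
  unfold leadingMinor
  congr 1
  ext i j
  exact h i i.isLt j j.isLt

theorem leadingPf_congr {R : Type*} [CommRing R] [Algebra ℚ R] {k : ℕ} {M N : ℕ → ℕ → R}
    (h : ∀ i < 2 * k, ∀ j < 2 * k, M i j = N i j) : leadingPf k M = leadingPf k N := by
  unfold leadingPf
  congr 1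
  ext i j
  exact h i i.isLt j j.isLt

theorem map_leadingMinor {R S : Type*} [CommRing R] [CommRing S] (φ : R →+* S) (n : ℕ)
    (M : ℕ → ℕ → R) : φ (leadingMinor n M) = leadingMinor n fun i j => φ (M i j) := by
  unfold leadingMinor
  rw [RingHom.map_det]
  rfl

theorem map_leadingPf {R S : Type*} [CommRing R] [Algebra ℚ R] [CommRing S] [Algebra ℚ S]
    (φ : R →+* S) (k : ℕ) (A : ℕ → ℕ → R) :
    φ (leadingPf k A) = leadingPf k fun i j => φ (A i j) := by
  unfold leadingPf
  rw [map_pfaffian]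
  rfl

theorem leadingMinor_zero {R : Type*} [CommRing R] (M : ℕ → ℕ → R) : leadingMinor 0 M = 1 := by
  simp [leadingMinor]

theorem leadingMinor_one {R : Type*} [CommRing R] (M : ℕ → ℕ → R) :
    leadingMinor 1 M = M 0 0 := by
  simp [leadingMinor]

theorem leadingMinor_two {R : Type*} [CommRing R] (M : ℕ → ℕ → R) :
    leadingMinor 2 M = M 0 0 * M 1 1 - M 0 1 * M 1 0 := by
  simp [leadingMinor, Matrix.det_fin_two]

theorem leadingPf_zero {R : Type*} [CommRing R] [Algebra ℚ R] (A : ℕ → ℕ → R) :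
    leadingPf 0 A = 1 := by
  simp [leadingPf, pfaffian]

theorem leadingPf_decouple {R : Type*} [CommRing R] [Algebra ℚ R] {k : ℕ}
    (A : ℕ → ℕ → R) (hA : ∀ i j, A i j = -A j i) (h0 : ∀ j, 2 ≤ j → A 0 j = 0) :
    leadingPf (k + 1) A = A 0 1 * leadingPf k fun i j => A (i + 2) (j + 2) :=
  pfaffian_decouple _ (fun _ _ => hA _ _) (fun j hj => h0 j hj)

theorem leadingPf_one {R : Type*} [CommRing R] [Algebra ℚ R] (A : ℕ → ℕ → R)
    (hA : ∀ i j, A i j = -A j i) : leadingPf 1 A = A 0 1 := by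
  have h : leadingPf 1 A = leadingPf 1 fun i j => if i < 2 ∧ j < 2 then A i j else 0 :=
    leadingPf_congr fun i hi j hj => by rw [if_pos ⟨by omega, by omega⟩]
  rw [h, leadingPf_decouple, leadingPf_zero]
  · simp
  · intro i j
    by_cases hij : i < 2 ∧ j < 2
    · rw [if_pos hij, if_pos hij.symm, hA]
    · rw [if_neg hij, if_neg fun h => hij h.symm, neg_zero]
  · intro j hj
    rw [if_neg]
    omega

/-- The Schur complement of the top left entry. -/
def schurOne {F : Type*} [Field F] (M : ℕ → ℕ → F) (i j : ℕ) : F :=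
  M (i + 1) (j + 1) - M (i + 1) 0 * M 0 (j + 1) / M 0 0

theorem leadingMinor_schurOne {F : Type*} [Field F] (n : ℕ) (M : ℕ → ℕ → F) (h : M 0 0 ≠ 0) :
    leadingMinor (n + 1) M = M 0 0 * leadingMinor n (schurOne M) := by
  unfold leadingMinor
  rw [Matrix.det_eq_of_forall_row_eq_smul_add_const
    (B := Matrix.of fun i j : Fin (n + 1) =>
      if (i : ℕ) = 0 then M i j else M i j - M i 0 / M 0 0 * M 0 j)
    (fun i => if (i : ℕ) = 0 then 0 else M i 0 / M 0 0) 0 (by simp)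
    (by
      intro i j
      simp only [Matrix.of_apply, Fin.val_zero, if_true]
      split_ifs <;> ring)]
  rw [Matrix.det_succ_column_zero, Fin.sum_univ_succ, Finset.sum_eq_zero, add_zero]
  · simp only [Fin.val_zero, pow_zero, Matrix.of_apply, if_true, one_mul]
    congr 2
    ext i j
    simp [schurOne]
    ring
  · intro i _
    simp [h]

/-- The Schur complement of the top left `2 × 2` block, when that block is skew-symmetric. -/
def schurTwo {F : Type*} [Field F] (M : ℕ → ℕ → F) (i j : ℕ) : F :=
  M (i + 2) (j + 2) + (M (i + 2) 0 * M 1 (j + 2) - M (i + 2) 1 * M 0 (j + 2)) / M 0 1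

theorem leadingMinor_perm {R : Type*} [CommRing R] {n : ℕ} (σ τ : Equiv.Perm (Fin n))
    {M N : ℕ → ℕ → R} (h : ∀ i j : Fin n, N i j = M (σ i) (τ j)) :
    leadingMinor n N = ((Equiv.Perm.sign σ : ℤ) : R) * ((Equiv.Perm.sign τ : ℤ) : R) *
      leadingMinor n M := by
  unfold leadingMinor
  have h1 : (Matrix.of fun i j : Fin n => N i j)
      = ((Matrix.of fun i j : Fin n => M i j).submatrix σ id).submatrix id τ := by
    ext i j
    exact h i j
  rw [h1, Matrix.det_permute', Matrix.det_permute]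
  ring

theorem leadingPf_perm {R : Type*} [CommRing R] [Algebra ℚ R] {k : ℕ}
    (σ : Equiv.Perm (Fin (2 * k))) {A B : ℕ → ℕ → R}
    (h : ∀ i j : Fin (2 * k), B i j = A (σ i) (σ j)) :
    leadingPf k B = ((Equiv.Perm.sign σ : ℤ) : R) * leadingPf k A := by
  unfold leadingPf
  rw [← pfaffian_submatrix_perm]
  congr 1
  ext i j
  exact h i j

theorem leadingMinor_schurTwo {F : Type*} [Field F] (n : ℕ) (M : ℕ → ℕ → F) (h : M 0 1 ≠ 0)
    (h00 : M 0 0 = 0) (h11 : M 1 1 = 0) (h10 : M 1 0 = -M 0 1) :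
    leadingMinor (n + 2) M = M 0 1 ^ 2 * leadingMinor n (schurTwo M) := by
  -- Exchanging the first two columns turns the pivot block into two `1 × 1` pivots.
  rw [leadingMinor_perm (M := fun i j => M i (if j = 0 then 1 else if j = 1 then 0 else j))
    1 (Equiv.swap 0 1), leadingMinor_schurOne, leadingMinor_schurOne, Equiv.Perm.sign_swap]
  · have h1 : schurOne (schurOne fun i j => M i (if j = 0 then 1 else if j = 1 then 0 else j))
        = schurTwo M := by
      ext i j
      simp only [schurOne, schurTwo]
      simp [h00, h11, h10]
      field_simp
      ring
    rw [h1]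
    simp [schurOne, h00, h11, h10]
    ring
  · simp
  · simpa [schurOne, h00, h11, h10] using h
  · simpa using h
  · intro i j
    simp only [Equiv.Perm.one_apply, Fin.coe_swap, Fin.val_zero, Fin.val_one]
    congr 1
    grind

/-- Simultaneously adding multiples of one row, and of the corresponding column, to the others
does not change the Pfaffian. -/
theorem leadingPf_add_mul {R : Type*} [CommRing R] [Algebra ℚ R] {n : ℕ} (A : ℕ → ℕ → R)
    (k : ℕ) (hk : k < 2 * n) (hA : A k k = 0) (c : ℕ → R) (hc : c k = 0) :
    leadingPf n (fun i j => A i j + c i * A k j + c j * A i k) = leadingPf n A := by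
  set e : Fin (2 * n) := ⟨k, hk⟩
  set U : Matrix (Fin (2 * n)) (Fin (2 * n)) R :=
    1 + Matrix.vecMulVec (fun i : Fin (2 * n) => c i) (Pi.single e 1) with hU
  have hdet : U.det = 1 := by
    rw [Matrix.det_eq_of_forall_row_eq_smul_add_const (B := 1) (fun i : Fin (2 * n) => c i) e hc,
      Matrix.det_one]
    intro i j
    simp [hU, Matrix.vecMulVec_apply, Matrix.one_apply, Pi.single_apply, eq_comm]
  unfold leadingPf
  rw [← one_mul (pfaffian (Matrix.of fun i j : Fin (2 * n) => A i j)), ← hdet,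
    ← pfaffian_congruence]
  congr 1
  have h1 : ∀ N : Matrix (Fin (2 * n)) (Fin (2 * n)) R, ∀ i j,
      (U * N) i j = N i j + c i * N e j := by
    intro N i j
    rw [hU, Matrix.add_mul, Matrix.one_mul, Matrix.add_apply]
    simp [Matrix.mul_apply, Matrix.vecMulVec_apply, Pi.single_apply]
  ext i j
  have h2 : ∀ N : Matrix (Fin (2 * n)) (Fin (2 * n)) R, ∀ i j,
      (N * U.transpose) i j = N i j + c j * N i e := by
    intro N i j
    rw [← Matrix.transpose_transpose (N * U.transpose), Matrix.transpose_apply,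
      Matrix.transpose_mul, Matrix.transpose_transpose, h1]
    rfl
  rw [h2, h1, h1]
  simp [e, hA]

theorem skew_self_eq_zero {R ι : Type*} [CommRing R] [Algebra ℚ R] {A : ι → ι → R}
    (hA : ∀ i j, A i j = -A j i) (i : ι) : A i i = 0 := by
  have h1 : (2 : R) * A i i = 0 := by linear_combination hA i i
  have h2 : ((2 : ℚ)⁻¹) • ((2 : ℚ) • A i i) = 0 := by
    rw [Algebra.smul_def (2 : ℚ), map_ofNat, h1, smul_zero]
  rwa [smul_smul, inv_mul_cancel₀ two_ne_zero, one_smul] at h2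

theorem leadingPf_schurTwo {F : Type*} [Field F] [Algebra ℚ F] (n : ℕ) (A : ℕ → ℕ → F)
    (hA : ∀ i j, A i j = -A j i) (h : A 0 1 ≠ 0) :
    leadingPf (n + 1) A = A 0 1 * leadingPf n (schurTwo A) := by
  have hd := skew_self_eq_zero hA
  have h10 := hA 1 0
  -- Clear column `1` with the help of row `0`, then column `0` with the help of row `1`.
  set c : ℕ → F := fun i => if i < 2 then 0 else -(A i 1 / A 0 1) with hc
  set d : ℕ → F := fun i => if i < 2 then 0 else A i 0 / A 0 1 with hd'
  set B : ℕ → ℕ → F := fun i j => A i j + c i * A 0 j + c j * A i 0 with hB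
  set C : ℕ → ℕ → F := fun i j => B i j + d i * B 1 j + d j * B i 1 with hC
  have e1 : leadingPf (n + 1) B = leadingPf (n + 1) A :=
    leadingPf_add_mul A 0 (by omega) (hd 0) c (by simp [hc])
  have e2 : leadingPf (n + 1) C = leadingPf (n + 1) B :=
    leadingPf_add_mul B 1 (by omega) (by simp [hB, hd, hc]) d (by simp [hd'])
  have hC0 : ∀ i j, C i j = -C j i := by
    intro i j
    simp only [hC, hB]
    rw [hA i j, hA 0 j, hA i 0, hA 1 j, hA i 1, h10]
    ring
  rw [← e1, ← e2, leadingPf_decouple C hC0]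
  · have hC1 : C 0 1 = A 0 1 := by simp [hC, hB, hc, hd']
    rw [hC1]
    congr 2
    ext i j
    have hi : ¬ (i + 2 < 2) := by omega
    have hj : ¬ (j + 2 < 2) := by omega
    simp only [hC, hB, hc, hd', schurTwo, hi, hj, if_false, one_lt_two, if_true, hd]
    rw [hA 1 (j + 2), h10]
    field_simp
    ring
  · intro j hj
    have hj' : ¬ (j < 2) := by omega
    simp only [hC, hB, hc, hd', hj', if_false, one_lt_two, zero_lt_two, if_true, hd]
    rw [hA 0 j]
    field_simp
    ring

/-! ### Identities for leading minors and leading Pfaffians -/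

/-- The embedding `ℕ → ℕ` whose range omits `{m, …, m + d - 1}`. -/
def skipAt (d m n : ℕ) : ℕ := if n < m then n else n + d

theorem schurOne_comp {F : Type*} [Field F] {M : ℕ → ℕ → F} {f g f' g' : ℕ → ℕ}
    (hf0 : f 0 = 0) (hg0 : g 0 = 0) (hf : ∀ i, f (i + 1) = f' i + 1)
    (hg : ∀ i, g (i + 1) = g' i + 1) :
    schurOne (fun i j => M (f i) (g j)) = fun i j => schurOne M (f' i) (g' j) := by
  funext i j
  simp only [schurOne, hf0, hg0, hf, hg]

theorem schurTwo_comp {F : Type*} [Field F] {M : ℕ → ℕ → F} {f g f' g' : ℕ → ℕ}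
    (hf0 : f 0 = 0) (hg0 : g 0 = 0) (hf1 : f 1 = 1) (hg1 : g 1 = 1)
    (hf : ∀ i, f (i + 2) = f' i + 2) (hg : ∀ i, g (i + 2) = g' i + 2) :
    schurTwo (fun i j => M (f i) (g j)) = fun i j => schurTwo M (f' i) (g' j) := by
  funext i j
  simp only [schurTwo, hf0, hg0, hf1, hg1, hf, hg]

theorem skipAt_zero_of_pos {d m : ℕ} (h : 0 < m) : skipAt d m 0 = 0 := if_pos h

theorem skipAt_one_of_lt {d m : ℕ} (h : 1 < m) : skipAt d m 1 = 1 := if_pos h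

theorem skipAt_add (d m c n : ℕ) : skipAt d (m + c) (n + c) = skipAt d m n + c := by
  unfold skipAt
  split_ifs <;> omega

theorem schurTwo_skew {F : Type*} [Field F] {A : ℕ → ℕ → F} (hA : ∀ i j, A i j = -A j i) (i j : ℕ) :
    schurTwo A i j = -schurTwo A j i := by
  simp only [schurTwo]
  rw [hA (i + 2) (j + 2), hA (i + 2) 0, hA (i + 2) 1, hA (j + 2) 0, hA (j + 2) 1]
  ring

theorem schurTwo_leadingPf_ne_zero {F : Type*} [Field F] [Algebra ℚ F] {A : ℕ → ℕ → F}
    (hA : ∀ i j, A i j = -A j i) (h : ∀ n, leadingPf n A ≠ 0) (n : ℕ) :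
    leadingPf n (schurTwo A) ≠ 0 := by
  have h1 : A 0 1 ≠ 0 := by rw [← leadingPf_one A hA]; exact h 1
  have h2 := h (n + 1)
  rw [leadingPf_schurTwo n A hA h1] at h2
  exact right_ne_zero_of_mul h2

/-- The Desnanot–Jacobi identity when all leading minors are nonzero, by eliminating `1 × 1`
pivots. -/
theorem desnanot_jacobi_of_ne_zero {F : Type*} [Field F] (m : ℕ) :
    ∀ (M : ℕ → ℕ → F), (∀ n, leadingMinor n M ≠ 0) →
    leadingMinor m M * leadingMinor (m + 2) M
      = leadingMinor (m + 1) M *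
          leadingMinor (m + 1) (fun i j => M (skipAt 1 m i) (skipAt 1 m j))
        - leadingMinor (m + 1) (fun i j => M i (skipAt 1 m j)) *
          leadingMinor (m + 1) (fun i j => M (skipAt 1 m i) j) := by
  induction m with
  | zero =>
    intro M h
    simp only [zero_add, leadingMinor_zero, leadingMinor_one, leadingMinor_two, skipAt]
    simp
  | succ m ih =>
    intro M h
    have h0 : M 0 0 ≠ 0 := by rw [← leadingMinor_one M]; exact h 1
    have h1 : ∀ n, leadingMinor n (schurOne M) ≠ 0 := by
      intro n
      have h2 := h (n + 1)
      rw [leadingMinor_schurOne n M h0] at h2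
      exact right_ne_zero_of_mul h2
    have hs : ∀ i, skipAt 1 (m + 1) (i + 1) = skipAt 1 m i + 1 := skipAt_add 1 m 1
    have hs0 : skipAt 1 (m + 1) 0 = 0 := rfl
    have key := ih (schurOne M) h1
    rw [leadingMinor_schurOne m M h0, leadingMinor_schurOne (m + 1) M h0,
      leadingMinor_schurOne (m + 2) M h0,
      leadingMinor_schurOne (m + 1) (fun i j => M (skipAt 1 (m + 1) i) (skipAt 1 (m + 1) j)) h0,
      leadingMinor_schurOne (m + 1) (fun i j => M i (skipAt 1 (m + 1) j)) h0,
      leadingMinor_schurOne (m + 1) (fun i j => M (skipAt 1 (m + 1) i) j) h0,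
      schurOne_comp hs0 hs0 hs hs, schurOne_comp (f := fun i => i) (f' := fun i => i)
        rfl hs0 (fun _ => rfl) hs, schurOne_comp (g := fun i => i) (g' := fun i => i)
        hs0 rfl hs (fun _ => rfl), hs0]
    linear_combination M 0 0 ^ 2 * key

/-- The relation `leadingPf_plucker` when all leading Pfaffians are nonzero, by eliminating
`2 × 2` pivots. -/
theorem leadingPf_plucker_of_ne_zero {F : Type*} [Field F] [Algebra ℚ F] (m : ℕ) :
    ∀ (A : ℕ → ℕ → F), (∀ i j, A i j = -A j i) → (∀ n, leadingPf n A ≠ 0) →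
    leadingPf (m + 1) A *
        leadingPf (m + 1) (fun i j => A (skipAt 2 (2 * m) i) (skipAt 2 (2 * m) j))
      - leadingPf m A * leadingPf (m + 2) A
      = leadingMinor (2 * m + 2) (fun i j => A i (skipAt 2 (2 * m) j)) := by
  induction m with
  | zero =>
    intro A hA h
    have h1 : A 0 1 ≠ 0 := by rw [← leadingPf_one A hA]; exact h 1
    rw [leadingPf_one A hA, leadingPf_one _ (fun i j => hA _ _), leadingPf_zero,
      leadingPf_schurTwo 1 A hA h1, leadingPf_one _ (schurTwo_skew hA), leadingMinor_two]
    simp only [skipAt, schurTwo, Nat.mul_zero, Nat.not_lt_zero, if_false, zero_add, Nat.reduceAdd]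
    rw [hA 2 0, hA 2 1]
    field_simp
    ring
  | succ m ih =>
    intro A hA h
    have h1 : A 0 1 ≠ 0 := by rw [← leadingPf_one A hA]; exact h 1
    have hs : ∀ i, skipAt 2 (2 * (m + 1)) (i + 2) = skipAt 2 (2 * m) i + 2 :=
      skipAt_add 2 (2 * m) 2
    have hs0 : skipAt 2 (2 * (m + 1)) 0 = 0 := skipAt_zero_of_pos (by omega)
    have hs1 : skipAt 2 (2 * (m + 1)) 1 = 1 := skipAt_one_of_lt (by omega)
    have hd := skew_self_eq_zero hA
    have key := ih (schurTwo A) (schurTwo_skew hA) (schurTwo_leadingPf_ne_zero hA h)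
    rw [leadingPf_schurTwo (m + 1) A hA h1, leadingPf_schurTwo m A hA h1,
      leadingPf_schurTwo (m + 2) A hA h1,
      leadingPf_schurTwo (m + 1) _ (fun i j => hA _ _) (by rwa [hs0, hs1]),
      show 2 * (m + 1) + 2 = 2 * m + 2 + 2 from rfl,
      leadingMinor_schurTwo (2 * m + 2) (fun i j => A i (skipAt 2 (2 * (m + 1)) j)) (by rwa [hs1])
        (by rw [hs0, hd]) (by rw [hs1, hd]) (by rw [hs0, hs1, hA]),
      schurTwo_comp hs0 hs0 hs1 hs1 hs hs, schurTwo_comp (f := fun i => i) (f' := fun i => i)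
        rfl hs0 rfl hs1 (fun _ => rfl) hs, hs0, hs1]
    linear_combination A 0 1 ^ 2 * key

/-- The relation `leadingPf_mul` when all leading Pfaffians are nonzero, by eliminating `2 × 2`
pivots. -/
theorem leadingPf_mul_of_ne_zero {F : Type*} [Field F] [Algebra ℚ F] (m : ℕ) :
    ∀ (A : ℕ → ℕ → F), (∀ i j, A i j = -A j i) → (∀ n, leadingPf n A ≠ 0) →
    leadingPf (m + 1) A *
        leadingPf (m + 1) (fun i j => A (skipAt 1 (2 * m + 1) i) (skipAt 1 (2 * m + 1) j))
      = leadingMinor (2 * m + 2) (fun i j => A i (skipAt 1 (2 * m + 1) j)) := by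
  induction m with
  | zero =>
    intro A hA h
    have hd := skew_self_eq_zero hA
    rw [leadingPf_one A hA, leadingPf_one _ (fun i j => hA _ _), leadingMinor_two]
    simp only [skipAt, Nat.mul_zero, zero_add, zero_lt_one, if_true, lt_irrefl, if_false, hd,
      Nat.reduceAdd]
    rw [hA 1 0]
    ring
  | succ m ih =>
    intro A hA h
    have h1 : A 0 1 ≠ 0 := by rw [← leadingPf_one A hA]; exact h 1
    have hs : ∀ i, skipAt 1 (2 * (m + 1) + 1) (i + 2) = skipAt 1 (2 * m + 1) i + 2 :=
      skipAt_add 1 (2 * m + 1) 2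
    have hs0 : skipAt 1 (2 * (m + 1) + 1) 0 = 0 := skipAt_zero_of_pos (by omega)
    have hs1 : skipAt 1 (2 * (m + 1) + 1) 1 = 1 := skipAt_one_of_lt (by omega)
    have hd := skew_self_eq_zero hA
    have key := ih (schurTwo A) (schurTwo_skew hA) (schurTwo_leadingPf_ne_zero hA h)
    rw [leadingPf_schurTwo (m + 1) A hA h1,
      leadingPf_schurTwo (m + 1) _ (fun i j => hA _ _) (by rwa [hs0, hs1]),
      show 2 * (m + 1) + 2 = 2 * m + 2 + 2 from rfl,
      leadingMinor_schurTwo (2 * m + 2) (fun i j => A i (skipAt 1 (2 * (m + 1) + 1) j))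
        (by rwa [hs1]) (by rw [hs0, hd]) (by rw [hs1, hd]) (by rw [hs0, hs1, hA]),
      schurTwo_comp hs0 hs0 hs1 hs1 hs hs, schurTwo_comp (f := fun i => i) (f' := fun i => i)
        rfl hs0 rfl hs1 (fun _ => rfl) hs, hs0, hs1]
    linear_combination A 0 1 ^ 2 * key

open Polynomial in
/-- The line from `J` to `A`, as a matrix of polynomials in the parameter. -/
noncomputable def polyPath {R : Type*} [CommRing R] (J A : ℕ → ℕ → R) (i j : ℕ) : R[X] :=
  C (J i j) + X * C (A i j - J i j)

theorem eval_zero_polyPath {R : Type*} [CommRing R] (J A : ℕ → ℕ → R) (i j : ℕ) :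
    Polynomial.evalRingHom 0 (polyPath J A i j) = J i j := by
  simp [polyPath]

theorem eval_one_polyPath {R : Type*} [CommRing R] (J A : ℕ → ℕ → R) (i j : ℕ) :
    Polynomial.evalRingHom 1 (polyPath J A i j) = A i j := by
  simp [polyPath]

/-- The standard symplectic matrix: the direct sum of copies of `[[0, 1], [-1, 0]]`. -/
def stdSkew (R : Type*) [CommRing R] (i j : ℕ) : R :=
  if i % 2 = 0 ∧ j = i + 1 then 1 else if j % 2 = 0 ∧ i = j + 1 then -1 else 0

theorem stdSkew_skew (R : Type*) [CommRing R] (i j : ℕ) : stdSkew R i j = -stdSkew R j i := by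
  unfold stdSkew
  split_ifs <;> first | omega | simp

theorem leadingPf_stdSkew (R : Type*) [CommRing R] [Algebra ℚ R] (n : ℕ) :
    leadingPf n (stdSkew R) = 1 := by
  induction n with
  | zero => exact leadingPf_zero _
  | succ n ih =>
    rw [leadingPf_decouple _ (stdSkew_skew R)]
    · have h : (fun i j => stdSkew R (i + 2) (j + 2)) = stdSkew R := by
        funext i j
        have h1 : (i + 2) % 2 = i % 2 := by omega
        have h2 : (j + 2) % 2 = j % 2 := by omega
        have h3 : j + 2 = i + 2 + 1 ↔ j = i + 1 := by omega
        have h4 : i + 2 = j + 2 + 1 ↔ i = j + 1 := by omega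
        simp only [stdSkew, h1, h2, h3, h4]
      rw [h, ih]
      simp [stdSkew]
    · intro j hj
      unfold stdSkew
      rw [if_neg (by omega), if_neg (by omega)]

/-- The Desnanot–Jacobi identity: the base block is `{0, …, m - 1}` and the two extra indices are
`m` and `m + 1`. -/
theorem desnanot_jacobi {R : Type*} [CommRing R] [IsDomain R] (m : ℕ) (M : ℕ → ℕ → R) :
    leadingMinor m M * leadingMinor (m + 2) M
      = leadingMinor (m + 1) M *
          leadingMinor (m + 1) (fun i j => M (skipAt 1 m i) (skipAt 1 m j))
        - leadingMinor (m + 1) (fun i j => M i (skipAt 1 m j)) *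
          leadingMinor (m + 1) (fun i j => M (skipAt 1 m i) j) := by
  set J : ℕ → ℕ → R := fun i j => if i = j then 1 else 0
  set φ := algebraMap (Polynomial R) (FractionRing (Polynomial R))
  have hφ : Function.Injective φ := IsFractionRing.injective _ _
  have hJ : ∀ n, leadingMinor n J = 1 := by
    intro n
    unfold leadingMinor
    rw [← Matrix.det_one (n := Fin n) (R := R)]
    congr 1
    ext i j
    simp [J, Matrix.one_apply, Fin.ext_iff]
  have key := desnanot_jacobi_of_ne_zero m (fun i j => φ (polyPath J M i j)) (by
    intro n
    rw [← map_leadingMinor, map_ne_zero_iff φ hφ]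
    intro h
    have h1 := congrArg (Polynomial.evalRingHom 0) h
    simp only [map_leadingMinor, eval_zero_polyPath, hJ, map_zero, one_ne_zero] at h1)
  simp only [← map_leadingMinor φ, ← map_mul, ← map_sub] at key
  have key2 := congrArg (Polynomial.evalRingHom 1) (hφ key)
  simp only [map_mul, map_sub, map_leadingMinor, eval_one_polyPath] at key2
  exact key2

theorem polyPath_skew {R : Type*} [CommRing R] {A : ℕ → ℕ → R} (hA : ∀ i j, A i j = -A j i)
    (i j : ℕ) : polyPath (stdSkew R) A i j = -polyPath (stdSkew R) A j i := by
  unfold polyPath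
  rw [stdSkew_skew R i j, hA i j]
  simp only [map_neg, map_sub]
  ring

theorem leadingPf_polyPath_ne_zero {R F : Type*} [CommRing R] [Nontrivial R] [Algebra ℚ R]
    [Field F] [Algebra ℚ F] {φ : Polynomial R →+* F} (hφ : Function.Injective φ) (A : ℕ → ℕ → R)
    (n : ℕ) : leadingPf n (fun i j => φ (polyPath (stdSkew R) A i j)) ≠ 0 := by
  rw [← map_leadingPf, map_ne_zero_iff φ hφ]
  intro h
  have h1 := congrArg (Polynomial.evalRingHom 0) h
  simp only [map_leadingPf, eval_zero_polyPath, leadingPf_stdSkew, map_zero, one_ne_zero] at h1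

/-- A Plücker relation for Pfaffians: the base block is `I = {0, …, 2m - 1}`, and with
`a, b, c, d` the next four indices, `Pf(I,a,b) Pf(I,c,d) - Pf(I) Pf(I,a,b,c,d)` is the minor with
rows `I, a, b` and columns `I, c, d`. -/
theorem leadingPf_plucker {R : Type*} [CommRing R] [IsDomain R] [Algebra ℚ R] (m : ℕ)
    (A : ℕ → ℕ → R) (hA : ∀ i j, A i j = -A j i) :
    leadingPf (m + 1) A *
        leadingPf (m + 1) (fun i j => A (skipAt 2 (2 * m) i) (skipAt 2 (2 * m) j))
      - leadingPf m A * leadingPf (m + 2) A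
      = leadingMinor (2 * m + 2) (fun i j => A i (skipAt 2 (2 * m) j)) := by
  set φ := algebraMap (Polynomial R) (FractionRing (Polynomial R))
  have hφ : Function.Injective φ := IsFractionRing.injective _ _
  have key := leadingPf_plucker_of_ne_zero m (fun i j => φ (polyPath (stdSkew R) A i j))
    (fun i j => by rw [polyPath_skew hA, map_neg]) (leadingPf_polyPath_ne_zero hφ A)
  simp only [← map_leadingPf φ, ← map_leadingMinor φ, ← map_mul, ← map_sub] at key
  have key2 := congrArg (Polynomial.evalRingHom 1) (hφ key)
  simp only [map_mul, map_sub, map_leadingPf, map_leadingMinor, eval_one_polyPath] at key2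
  exact key2

/-- With `I = {0, …, 2m - 1}` and `b, a, c` the next three indices, `Pf(I,b,a) Pf(I,b,c)` is the
minor with rows `I, b, a` and columns `I, b, c`. -/
theorem leadingPf_mul {R : Type*} [CommRing R] [IsDomain R] [Algebra ℚ R] (m : ℕ)
    (A : ℕ → ℕ → R) (hA : ∀ i j, A i j = -A j i) :
    leadingPf (m + 1) A *
        leadingPf (m + 1) (fun i j => A (skipAt 1 (2 * m + 1) i) (skipAt 1 (2 * m + 1) j))
      = leadingMinor (2 * m + 2) (fun i j => A i (skipAt 1 (2 * m + 1) j)) := by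
  set φ := algebraMap (Polynomial R) (FractionRing (Polynomial R))
  have hφ : Function.Injective φ := IsFractionRing.injective _ _
  have key := leadingPf_mul_of_ne_zero m (fun i j => φ (polyPath (stdSkew R) A i j))
    (fun i j => by rw [polyPath_skew hA, map_neg]) (leadingPf_polyPath_ne_zero hφ A)
  simp only [← map_leadingPf φ, ← map_leadingMinor φ, ← map_mul] at key
  have key2 := congrArg (Polynomial.evalRingHom 1) (hφ key)
  simp only [map_mul, map_leadingPf, map_leadingMinor, eval_one_polyPath] at key2
  exact key2

/-! ### Identities for consecutive blocks and for Toeplitz determinants -/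

theorem coe_finRotate_eq_mod {N : ℕ} (i : Fin N) : ((finRotate N i : Fin N) : ℕ) = (i + 1) % N := by
  cases N with
  | zero => exact i.elim0
  | succ N =>
    rw [finRotate_apply, Fin.val_add, Fin.val_one', Nat.add_mod_mod]

theorem leadingMinor_rotate {R ι : Type*} [CommRing R] {n : ℕ} (P : ι → ι → R) (f g f' g' : ℕ → ι)
    (hf : ∀ i < n, f' i = f ((i + 1) % n)) (hg : ∀ i < n, g' i = g ((i + 1) % n)) :
    leadingMinor n (fun i j => P (f' i) (g' j)) = leadingMinor n fun i j => P (f i) (g j) := by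
  rw [leadingMinor_perm (finRotate n) (finRotate n) (M := fun i j => P (f i) (g j)),
    ← Int.cast_mul, Int.units_coe_mul_self, Int.cast_one, one_mul]
  intro i j
  simp only [coe_finRotate_eq_mod]
  rw [hf i i.isLt, hg j j.isLt]

theorem leadingMinor_rotate_left {R ι : Type*} [CommRing R] {n : ℕ} (P : ι → ι → R)
    (f g f' : ℕ → ι) (hf : ∀ i < n, f' i = f ((i + 1) % n)) :
    leadingMinor n (fun i j => P (f' i) (g j))
      = (-1) ^ (n - 1) * leadingMinor n fun i j => P (f i) (g j) := by
  rw [leadingMinor_perm (finRotate n) 1 (M := fun i j => P (f i) (g j))]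
  · simp [sign_finRotate]
  intro i j
  simp only [coe_finRotate_eq_mod, Equiv.Perm.one_apply]
  rw [hf i i.isLt]

theorem leadingMinor_rotate_right {R ι : Type*} [CommRing R] {n : ℕ} (P : ι → ι → R)
    (f g g' : ℕ → ι) (hg : ∀ i < n, g' i = g ((i + 1) % n)) :
    leadingMinor n (fun i j => P (f i) (g' j))
      = (-1) ^ (n - 1) * leadingMinor n fun i j => P (f i) (g j) := by
  rw [leadingMinor_perm 1 (finRotate n) (M := fun i j => P (f i) (g j))]
  · simp [sign_finRotate]
  intro i j
  simp only [coe_finRotate_eq_mod, Equiv.Perm.one_apply]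
  rw [hg j j.isLt]

theorem leadingMinor_rotate_two_right {R ι : Type*} [CommRing R] {n : ℕ} (P : ι → ι → R)
    (f g g' : ℕ → ι) (hg : ∀ i < n, g' i = g ((i + 2) % n)) :
    leadingMinor n (fun i j => P (f i) (g' j)) = leadingMinor n fun i j => P (f i) (g j) := by
  rw [leadingMinor_rotate_right P f (fun i => g ((i + 1) % n)) g',
    leadingMinor_rotate_right P f g (fun i => g ((i + 1) % n)), ← mul_assoc, ← mul_pow]
  · simp
  · exact fun i _ => rfl
  · intro i hi
    rw [hg i hi, Nat.mod_add_mod]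

theorem leadingPf_rotate {R ι : Type*} [CommRing R] [Algebra ℚ R] {k : ℕ} (P : ι → ι → R)
    (f f' : ℕ → ι) (hf : ∀ i < 2 * k, f' i = f ((i + 1) % (2 * k))) :
    leadingPf k (fun i j => P (f' i) (f' j))
      = (-1) ^ (2 * k - 1) * leadingPf k fun i j => P (f i) (f j) := by
  rw [leadingPf_perm (finRotate (2 * k)) (A := fun i j => P (f i) (f j))]
  · simp [sign_finRotate]
  intro i j
  simp only [coe_finRotate_eq_mod]
  rw [hf i i.isLt, hf j j.isLt]

theorem leadingPf_rotate_two {R ι : Type*} [CommRing R] [Algebra ℚ R] {k : ℕ} (P : ι → ι → R)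
    (f f' : ℕ → ι) (hf : ∀ i < 2 * k, f' i = f ((i + 2) % (2 * k))) :
    leadingPf k (fun i j => P (f' i) (f' j)) = leadingPf k fun i j => P (f i) (f j) := by
  rw [leadingPf_rotate P (fun i => f ((i + 1) % (2 * k))) f',
    leadingPf_rotate P f (fun i => f ((i + 1) % (2 * k))), ← mul_assoc, ← mul_pow]
  · simp
  · exact fun i _ => rfl
  · intro i hi
    rw [hf i hi, Nat.mod_add_mod]

/-- The matrix `P` seen from position `(s, s)`. -/
def windowAt {R : Type*} (P : ℤ → ℤ → R) (s : ℤ) (i j : ℕ) : R := P (s + i) (s + j)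

/-- The Plücker relation for Pfaffians of consecutive principal blocks. -/
theorem leadingPf_windowAt_plucker {R : Type*} [CommRing R] [IsDomain R] [Algebra ℚ R] (m : ℕ)
    (P : ℤ → ℤ → R) (hP : ∀ i j, P i j = -P j i) (s : ℤ) :
    leadingPf (m + 1) (windowAt P s) * leadingPf (m + 1) (windowAt P (s + 2))
      - leadingPf (m + 2) (windowAt P s) * leadingPf m (windowAt P (s + 2))
      = leadingMinor (2 * (m + 1)) fun i j => P (s + 2 + i) (s + j) := by
  -- In the order `s + 2, …, s + 2m + 3, s, s + 1` the common block comes first; the consecutive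
  -- blocks that start at `s` are recovered by a cyclic rotation by two, which is even.
  set o : ℕ → ℤ := fun n => if n < 2 * m + 2 then s + 2 + n else s + n - (2 * m + 2) with ho
  have key := leadingPf_plucker m (fun i j => P (o i) (o j)) (fun i j => hP _ _)
  have ho1 : ∀ n < 2 * m + 2, o n = s + 2 + n := fun n hn => if_pos hn
  have ho2 : ∀ n < 2 * m + 2, o (skipAt 2 (2 * m) n) = s + ((n + 2) % (2 * m + 2) : ℕ) := by
    intro n hn
    by_cases h : n < 2 * m
    · rw [skipAt, if_pos h, Nat.mod_eq_of_lt (by omega), ho1 n hn]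
      push_cast
      ring
    · have h1 : (n + 2) % (2 * m + 2) = n - 2 * m := by
        rw [Nat.mod_eq_sub_mod (by omega), Nat.mod_eq_of_lt (by omega)]
        omega
      rw [h1]
      simp only [skipAt, h, if_false, ho]
      rw [if_neg (by omega)]
      omega
  have ho3 : ∀ n < 2 * (m + 2), o n = s + ((n + 2) % (2 * (m + 2)) : ℕ) := by
    intro n hn
    by_cases h : n < 2 * m + 2
    · rw [Nat.mod_eq_of_lt (by omega), ho1 n h]
      push_cast
      ring
    · have h1 : (n + 2) % (2 * (m + 2)) = n - (2 * m + 2) := by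
        rw [Nat.mod_eq_sub_mod (by omega), Nat.mod_eq_of_lt (by omega)]
        omega
      rw [h1]
      simp only [h, if_false, ho]
      omega
  have e1 : leadingPf (m + 1) (fun i j => P (o i) (o j))
      = leadingPf (m + 1) (windowAt P (s + 2)) :=
    leadingPf_congr fun i hi j hj => by rw [ho1 i (by omega), ho1 j (by omega), windowAt]
  have e2 : leadingPf m (fun i j => P (o i) (o j)) = leadingPf m (windowAt P (s + 2)) :=
    leadingPf_congr fun i hi j hj => by rw [ho1 i (by omega), ho1 j (by omega), windowAt]
  have e3 : leadingPf (m + 2) (fun i j => P (o i) (o j)) = leadingPf (m + 2) (windowAt P s) :=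
    leadingPf_rotate_two P (fun n => s + n) o ho3
  have e4 : leadingPf (m + 1) (fun i j => P (o (skipAt 2 (2 * m) i)) (o (skipAt 2 (2 * m) j)))
      = leadingPf (m + 1) (windowAt P s) :=
    leadingPf_rotate_two P (fun n => s + n) (fun n => o (skipAt 2 (2 * m) n)) ho2
  have e5 : leadingMinor (2 * m + 2) (fun i j => P (o i) (o (skipAt 2 (2 * m) j)))
      = leadingMinor (2 * m + 2) fun i j => P (s + 2 + i) (s + j) := by
    rw [leadingMinor_rotate_two_right P o (fun n => s + n) (fun n => o (skipAt 2 (2 * m) n)) ho2]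
    exact leadingMinor_congr fun i hi j hj => by rw [ho1 i hi]
  rw [e1, e2, e3, e4, e5] at key
  rw [show 2 * (m + 1) = 2 * m + 2 from rfl, ← key]
  ring

/-- The product of the Pfaffians of two principal blocks that differ by a translation by one. -/
theorem leadingPf_windowAt_mul {R : Type*} [CommRing R] [IsDomain R] [Algebra ℚ R] (m : ℕ)
    (P : ℤ → ℤ → R) (hP : ∀ i j, P i j = -P j i) (s : ℤ) :
    leadingPf (m + 1) (windowAt P s) * leadingPf (m + 1) (windowAt P (s + 1))
      = leadingMinor (2 * (m + 1)) fun i j => P (s + 1 + i) (s + j) := by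
  -- In the order `s + 1, …, s + 2m + 2, s` the common block `s + 1, …, s + 2m + 1` comes first; the
  -- cyclic rotation to the natural order is odd, and its signs cancel between the two sides.
  set o : ℕ → ℤ := fun n => if n < 2 * m + 2 then s + 1 + n else s with ho
  have key := leadingPf_mul m (fun i j => P (o i) (o j)) (fun i j => hP _ _)
  have ho1 : ∀ n < 2 * m + 2, o n = s + 1 + n := fun n hn => if_pos hn
  have ho2 : ∀ n < 2 * m + 2, o (skipAt 1 (2 * m + 1) n) = s + ((n + 1) % (2 * m + 2) : ℕ) := by
    intro n hn
    by_cases h : n < 2 * m + 1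
    · rw [skipAt, if_pos h, Nat.mod_eq_of_lt (by omega), ho1 n hn]
      push_cast
      ring
    · have h1 : (n + 1) % (2 * m + 2) = 0 := by
        rw [Nat.mod_eq_sub_mod (by omega), Nat.mod_eq_of_lt (by omega)]
        omega
      rw [h1]
      simp only [skipAt, h, if_false, ho]
      rw [if_neg (by omega)]
      simp
  have hsign : (-1 : R) ^ (2 * m + 2 - 1) = -1 := by
    rw [show 2 * m + 2 - 1 = 2 * m + 1 from rfl, pow_succ, pow_mul]
    simp
  have e1 : leadingPf (m + 1) (fun i j => P (o i) (o j))
      = leadingPf (m + 1) (windowAt P (s + 1)) :=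
    leadingPf_congr fun i hi j hj => by rw [ho1 i (by omega), ho1 j (by omega), windowAt]
  have e4 : leadingPf (m + 1)
      (fun i j => P (o (skipAt 1 (2 * m + 1) i)) (o (skipAt 1 (2 * m + 1) j)))
      = (-1) ^ (2 * m + 2 - 1) * leadingPf (m + 1) (windowAt P s) :=
    leadingPf_rotate P (fun n => s + n) (fun n => o (skipAt 1 (2 * m + 1) n)) ho2
  have e5 : leadingMinor (2 * m + 2) (fun i j => P (o i) (o (skipAt 1 (2 * m + 1) j)))
      = (-1) ^ (2 * m + 2 - 1) * leadingMinor (2 * m + 2) fun i j => P (s + 1 + i) (s + j) := by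
    rw [leadingMinor_rotate_right P o (fun n => s + n) (fun n => o (skipAt 1 (2 * m + 1) n)) ho2]
    congr 1
    exact leadingMinor_congr fun i hi j hj => by rw [ho1 i hi]
  rw [e1, e4, e5, hsign] at key
  rw [show 2 * (m + 1) = 2 * m + 2 from rfl]
  linear_combination -key

/-- The Toeplitz determinant `det (h (c + j - i))` of size `n`. -/
def toeplitzDet {R : Type*} [CommRing R] (h : ℤ → R) (n : ℕ) (c : ℤ) : R :=
  leadingMinor n fun i j => h (c + j - i)

/-- The Desnanot–Jacobi identity for Toeplitz determinants. -/
theorem toeplitzDet_desnanot_jacobi {R : Type*} [CommRing R] [IsDomain R] (h : ℤ → R) (m : ℕ)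
    (c : ℤ) :
    toeplitzDet h (m + 1) c ^ 2 - toeplitzDet h (m + 2) c * toeplitzDet h m c
      = toeplitzDet h (m + 1) (c - 1) * toeplitzDet h (m + 1) (c + 1) := by
  -- In the order `1, …, m + 1, 0` the common block `1, …, m` of the two principal blocks of size
  -- `m + 1` comes first.
  set o : ℕ → ℤ := fun n => if n < m + 1 then n + 1 else 0 with ho
  set M : ℤ → ℤ → R := fun i j => h (c + j - i) with hM
  have key := desnanot_jacobi m (fun i j => M (o i) (o j))
  have ho1 : ∀ n < m + 1, o n = n + 1 := fun n hn => if_pos hn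
  have ho2 : ∀ n < m + 1, o (skipAt 1 m n) = ((n + 1) % (m + 1) : ℕ) := by
    intro n hn
    by_cases h : n < m
    · rw [skipAt, if_pos h, Nat.mod_eq_of_lt (by omega), ho1 n hn]
      push_cast
      ring
    · have h1 : (n + 1) % (m + 1) = 0 := by
        rw [Nat.mod_eq_sub_mod (by omega), Nat.mod_eq_of_lt (by omega)]
        omega
      rw [h1]
      simp only [skipAt, h, if_false, ho]
      rw [if_neg (by omega)]
      simp
  have ho3 : ∀ n < m + 2, o n = ((n + 1) % (m + 2) : ℕ) := by
    intro n hn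
    by_cases h : n < m + 1
    · rw [Nat.mod_eq_of_lt (by omega), ho1 n h]
      push_cast
      ring
    · have h1 : (n + 1) % (m + 2) = 0 := by
        rw [Nat.mod_eq_sub_mod (by omega), Nat.mod_eq_of_lt (by omega)]
        omega
      rw [h1]
      simp only [h, if_false, ho]
      simp
  have e0 : leadingMinor m (fun i j => M (o i) (o j)) = toeplitzDet h m c :=
    leadingMinor_congr fun i hi j hj => by
      rw [ho1 i (by omega), ho1 j (by omega)]
      exact congrArg h (by ring)
  have e1 : leadingMinor (m + 1) (fun i j => M (o i) (o j)) = toeplitzDet h (m + 1) c :=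
    leadingMinor_congr fun i hi j hj => by
      rw [ho1 i (by omega), ho1 j (by omega)]
      exact congrArg h (by ring)
  have e2 : leadingMinor (m + 2) (fun i j => M (o i) (o j)) = toeplitzDet h (m + 2) c :=
    leadingMinor_rotate M (fun n => n) (fun n => n) o o ho3 ho3
  have e3 : leadingMinor (m + 1) (fun i j => M (o (skipAt 1 m i)) (o (skipAt 1 m j)))
      = toeplitzDet h (m + 1) c :=
    leadingMinor_rotate M (fun n => n) (fun n => n) (fun n => o (skipAt 1 m n))
      (fun n => o (skipAt 1 m n)) ho2 ho2
  have e4 : leadingMinor (m + 1) (fun i j => M (o i) (o (skipAt 1 m j)))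
      = (-1) ^ m * toeplitzDet h (m + 1) (c - 1) := by
    rw [leadingMinor_rotate_right M o (fun n => n) (fun n => o (skipAt 1 m n)) ho2,
      Nat.add_sub_cancel]
    congr 1
    exact leadingMinor_congr fun i hi j hj => by
      rw [ho1 i (by omega)]
      exact congrArg h (by ring)
  have e5 : leadingMinor (m + 1) (fun i j => M (o (skipAt 1 m i)) (o j))
      = (-1) ^ m * toeplitzDet h (m + 1) (c + 1) := by
    rw [leadingMinor_rotate_left M (fun n => n) o (fun n => o (skipAt 1 m n)) ho2,
      Nat.add_sub_cancel]
    congr 1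
    exact leadingMinor_congr fun i hi j hj => by
      rw [ho1 j (by omega)]
      exact congrArg h (by ring)
  rw [e0, e1, e2, e3, e4, e5] at key
  have hsign : (-1 : R) ^ m * (-1) ^ m = 1 := by rw [← mul_pow]; simp
  linear_combination -key + toeplitzDet h (m + 1) (c - 1) * toeplitzDet h (m + 1) (c + 1) * hsign

/-! ### Determinants in even-odd block form -/

theorem leadingMinor_succ_of_column {R : Type*} [CommRing R] (n : ℕ) (M : ℕ → ℕ → R)
    (h0 : M 0 0 = 1) (h : ∀ i, M (i + 1) 0 = 0) :
    leadingMinor (n + 1) M = leadingMinor n fun i j => M (i + 1) (j + 1) := by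
  unfold leadingMinor
  rw [Matrix.det_succ_column_zero, Fin.sum_univ_succ, Finset.sum_eq_zero, add_zero]
  · simp only [Fin.val_zero, pow_zero, Matrix.of_apply, h0, one_mul]
    congr 1
  · intro i _
    simp [h]

theorem leadingMinor_succ_of_row {R : Type*} [CommRing R] (n : ℕ) (M : ℕ → ℕ → R)
    (h0 : M n n = 1) (h : ∀ j < n, M n j = 0) :
    leadingMinor (n + 1) M = leadingMinor n M := by
  unfold leadingMinor
  rw [Matrix.det_succ_row _ (Fin.last n), Fin.sum_univ_castSucc, Finset.sum_eq_zero, zero_add]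
  · simp only [Fin.val_last, Matrix.of_apply, h0, mul_one, ← two_mul, pow_mul, neg_one_sq, one_pow,
      one_mul]
    congr 1
    ext i j
    simp
  · intro i _
    simp [h i i.isLt]

theorem leadingMinor_upper_unitriangular {R : Type*} [CommRing R] (n : ℕ) (M : ℕ → ℕ → R)
    (h0 : ∀ i, M i i = 1) (h : ∀ i j, j < i → M i j = 0) : leadingMinor n M = 1 := by
  unfold leadingMinor
  rw [Matrix.det_of_isUpperTriangular]
  · simp [h0]
  · intro i j hij
    exact h i j hij

/-- The ordering of `Fin (2 * k)` with the even positions first. -/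
def evenOddEquiv (k : ℕ) : Fin k ⊕ Fin k ≃ Fin (2 * k) where
  toFun := Sum.elim (fun i => ⟨2 * i, by omega⟩) (fun i => ⟨2 * i + 1, by omega⟩)
  invFun p := if (p : ℕ) % 2 = 0 then Sum.inl ⟨p / 2, by omega⟩ else Sum.inr ⟨p / 2, by omega⟩
  left_inv := by
    rintro (i | i)
    · simp
    · have h1 : (2 * (i : ℕ) + 1) % 2 = 1 := by omega
      have h2 : (2 * (i : ℕ) + 1) / 2 = i := by omega
      simp [h1, h2]
  right_inv p := by
    by_cases h : (p : ℕ) % 2 = 0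
    · ext
      simp [h]
      omega
    · ext
      simp [h]
      omega

theorem leadingMinor_even_odd {R : Type*} [CommRing R] (k : ℕ) (M : ℕ → ℕ → R) :
    leadingMinor (2 * k) M = (Matrix.fromBlocks
      (Matrix.of fun i j : Fin k => M (2 * i) (2 * j))
      (Matrix.of fun i j : Fin k => M (2 * i) (2 * j + 1))
      (Matrix.of fun i j : Fin k => M (2 * i + 1) (2 * j))
      (Matrix.of fun i j : Fin k => M (2 * i + 1) (2 * j + 1))).det := by
  unfold leadingMinor
  rw [← Matrix.det_submatrix_equiv_self (evenOddEquiv k)]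
  congr 1
  ext (i | i) (j | j) <;> rfl

theorem det_fromBlocks_swap_rows {R : Type*} [CommRing R] {k : ℕ}
    (A B C D : Matrix (Fin k) (Fin k) R) :
    (Matrix.fromBlocks A B C D).det = (-1) ^ k * (Matrix.fromBlocks C D A B).det := by
  let e : Matrix (Fin k) (Fin k) R := 1
  have h1 : Matrix.fromBlocks A B C D
      = Matrix.fromBlocks 0 e e 0 * Matrix.fromBlocks C D A B := by
    simp [e, Matrix.fromBlocks_multiply]
  have h2 : (Matrix.fromBlocks 0 e e 0).det = (-1) ^ k := by
    have h3 : Matrix.fromBlocks 1 e e 0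
        = Matrix.fromBlocks 0 e e 0 * Matrix.fromBlocks 1 0 e 1 := by
      simp [e, Matrix.fromBlocks_multiply]
    have h4 := congrArg Matrix.det h3
    rw [Matrix.det_fromBlocks_one₁₁, Matrix.det_mul, Matrix.det_fromBlocks_zero₁₂] at h4
    simpa [e, Matrix.det_neg] using h4.symm
  rw [h1, Matrix.det_mul, h2]

theorem det_fromBlocks_of_mul {R : Type*} [CommRing R] {k : ℕ} (D Y B A : Matrix (Fin k) (Fin k) R)
    (hD : D.det = 1) : (Matrix.fromBlocks D (D * Y) B A).det = (A - B * Y).det := by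
  have h1 : Matrix.fromBlocks D (D * Y) B A
      = Matrix.fromBlocks D 0 B (A - B * Y) * Matrix.fromBlocks 1 Y 0 1 := by
    simp [Matrix.fromBlocks_multiply]
  rw [h1, Matrix.det_mul, Matrix.det_fromBlocks_zero₁₂, Matrix.det_fromBlocks_zero₂₁, hD]
  simp

/-- Extraction of a single term of a sum, where the index `c` may exceed the range because `f`
vanishes there. -/
theorem sum_ite_eq_mul_of_vanish {R : Type*} [CommRing R] {k : ℕ} (c : ℤ) (hc : 0 ≤ c) (x : R)
    (f : ℤ → R) (hf : ∀ n, (k : ℤ) ≤ n → f n = 0) :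
    ∑ l : Fin k, (if (l : ℤ) = c then x else 0) * f l = x * f c := by
  by_cases h : c < k
  · rw [Finset.sum_eq_single ⟨c.toNat, by omega⟩]
    · rw [if_pos (by simp only []; omega)]
      simp only [Int.toNat_of_nonneg hc]
    · intro l _ hl
      rw [if_neg, zero_mul]
      intro h2
      apply hl
      ext
      simp only []
      omega
    · simp
  · rw [hf c (by omega), mul_zero]
    refine Finset.sum_eq_zero fun l _ => ?_
    rw [if_neg (by omega), zero_mul]

/-! ### The matrices `𝒯 + ℰ` and their elimination -/

section Entries

variable {R : Type*} [CommRing R] (r : ℕ) (t : ℕ → R)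

/-- The entries of `𝒯` in odd rows and odd columns, as a function of half the difference of the
column and the row. -/
def oddCoeff (d : ℤ) : R :=
  if -1 ≤ d ∧ d ≤ r - 3 then krX t (d + 1)
  else if r - 1 ≤ d ∧ d ≤ 2 * r - 3 then -krX t (2 * r - 3 - d) else 0

theorem calT_odd_odd (m n : ℤ) : calT r t (2 * m + 1) (2 * n + 1) = oddCoeff r t (n - m) := by
  have h0 : Odd (2 * m + 1) := odd_two_mul_add_one m
  have h1 : 2 * m + 1 - (2 * n + 1) = 2 * (m - n) := by ring
  have h2 : 2 * n + 1 - (2 * m + 1) = 2 * (n - m) := by ring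
  have h3 : Even (2 * (m - n)) := even_two_mul _
  have h4 : 2 * (m - n) / 2 = m - n := by omega
  have h5 : 2 * (n - m) / 2 = n - m := by omega
  have h6 : ¬ (2 * (m - n) = 5 - 2 * (r : ℤ)) := by omega
  have h7 : ¬ (2 * (m - n) = 3 - 2 * (r : ℤ)) := by omega
  have h8 : 3 - (r : ℤ) ≤ m - n ∧ m - n ≤ 1 ↔ -1 ≤ n - m ∧ n - m ≤ r - 3 := by omega
  have h9 : 3 - 2 * (r : ℤ) ≤ m - n ∧ m - n ≤ 1 - r ↔ (r : ℤ) - 1 ≤ n - m ∧ n - m ≤ 2 * r - 3 := by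
    omega
  have h10 : m - n + 2 * (r : ℤ) - 3 = 2 * r - 3 - (n - m) := by ring
  simp only [calT, Matrix.of_apply, h0, if_true, h1, h2, h3, h4, h5, h6, h7, if_false, true_and, h8,
    h9, h10, oddCoeff]

theorem calT_odd_even (m n : ℤ) : calT r t (2 * m + 1) (2 * n)
    = (if n = m + r - 2 then -krX t ((r : ℤ) - 1) else 0)
      + (if n = m + r - 1 then -krX t r else 0) := by
  have h0 : Odd (2 * m + 1) := odd_two_mul_add_one m
  have h3 : ¬ Even (2 * m + 1 - 2 * n) := by rw [Int.even_iff]; omega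
  have h6 : 2 * m + 1 - 2 * n = 5 - 2 * (r : ℤ) ↔ n = m + r - 2 := by omega
  have h7 : 2 * m + 1 - 2 * n = 3 - 2 * (r : ℤ) ↔ n = m + r - 1 := by omega
  simp only [calT, Matrix.of_apply, h0, if_true, h3, h6, h7, if_false, false_and]
  split_ifs <;> first | omega | simp

theorem calT_even (m j : ℤ) : calT r t (2 * m) j = 0 := by
  have h0 : ¬ Odd (2 * m) := by rw [Int.odd_iff]; omega
  simp only [calT, Matrix.of_apply, h0, if_false]

theorem calE_odd (m j : ℤ) : calE r t (2 * m + 1) j = 0 := by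
  have h0 : ¬ Even (2 * m + 1) := by rw [Int.even_iff]; omega
  simp only [calE, Matrix.of_apply, h0, if_false]

theorem calE_even_even (m n : ℤ) : calE r t (2 * m) (2 * n)
    = (if n = m then 1 else 0) + (if n = m + 2 then -1 else 0) := by
  have h0 : Even (2 * m) := even_two_mul m
  have h1 : 2 * m = 2 * n ↔ n = m := by omega
  have h2 : 2 * m = 2 * n - 4 ↔ n = m + 2 := by omega
  have h3 : ¬ (2 * m = 2 * n - 3) := by omega
  have h4 : ¬ (2 * m = 2 * n - 1) := by omega
  simp only [calE, Matrix.of_apply, h0, if_true, h1, h2, h3, h4, if_false]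
  split_ifs <;> first | omega | simp

theorem calE_even_odd (m n : ℤ) : calE r t (2 * m) (2 * n + 1)
    = (if n = m then krX t r else 0) + (if n = m + 1 then krX t ((r : ℤ) - 1) else 0) := by
  have h0 : Even (2 * m) := even_two_mul m
  have h1 : ¬ (2 * m = 2 * n + 1) := by omega
  have h2 : ¬ (2 * m = 2 * n + 1 - 4) := by omega
  have h3 : 2 * m = 2 * n + 1 - 3 ↔ n = m + 1 := by omega
  have h4 : 2 * m = 2 * n + 1 - 1 ↔ n = m := by omega
  simp only [calE, Matrix.of_apply, h0, if_true, h1, h2, h3, h4, if_false]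
  split_ifs <;> first | omega | simp

/-- The doubly infinite matrix `𝒯 + ℰ`, where the columns of `𝒯` are displaced so that `T_k^a` is
its principal minor on the indices `1, …, 2k - 1`. -/
def krFull (a i j : ℤ) : R := calT r t i (j + 2 * a - 2) + calE r t i j

theorem krFull_shift (a i j : ℤ) : krFull r t a (i + 2) (j + 2) = krFull r t a i j := by
  rw [krFull, krFull, calE_shift, show j + 2 + 2 * a - 2 = j + 2 * a - 2 + 2 by ring, calT_shift]

theorem krFull_odd_odd (a m n : ℤ) :
    krFull r t a (2 * m + 1) (2 * n + 1) = oddCoeff r t (n - m + a - 1) := by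
  rw [krFull, calE_odd, add_zero, show 2 * n + 1 + 2 * a - 2 = 2 * (n + a - 1) + 1 by ring,
    calT_odd_odd]
  congr 1
  ring

theorem krFull_odd_even (a m n : ℤ) : krFull r t a (2 * m + 1) (2 * n)
    = (if n = m + r - 1 - a then -krX t ((r : ℤ) - 1) else 0)
      + (if n = m + r - a then -krX t r else 0) := by
  rw [krFull, calE_odd, add_zero, show 2 * n + 2 * a - 2 = 2 * (n + a - 1) by ring,
    calT_odd_even]
  have h1 : n + a - 1 = m + r - 2 ↔ n = m + r - 1 - a := by omega
  have h2 : n + a - 1 = m + r - 1 ↔ n = m + r - a := by omega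
  rw [if_congr h1 rfl rfl, if_congr h2 rfl rfl]

theorem krFull_even (a m j : ℤ) : krFull r t a (2 * m) j = calE r t (2 * m) j := by
  rw [krFull, calT_even, zero_add]

/-- The coefficients of the power series `(v + u z) / (1 - z ^ 2)`, where `u = x^(r-1)` and
`v = x^r`. -/
def altCoeff (s : ℤ) : R :=
  if s < 0 then 0 else if Even s then krX t r else krX t ((r : ℤ) - 1)

theorem altCoeff_of_neg {s : ℤ} (h : s < 0) : altCoeff r t s = 0 := if_pos h

/-- Multiplication by `1 - z ^ 2` turns the series into the polynomial `v + u z`. -/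
theorem altCoeff_sub (s : ℤ) : altCoeff r t s - altCoeff r t (s - 2)
    = (if s = 0 then krX t r else 0) + (if s = 1 then krX t ((r : ℤ) - 1) else 0) := by
  unfold altCoeff
  have h : Even (s - 2) ↔ Even s := by simp only [Int.even_iff]; omega
  simp only [h]
  by_cases h0 : s = 0
  · subst h0
    simp
  by_cases h1 : s = 1
  · subst h1
    simp
  by_cases h2 : s < 0
  · rw [if_pos h2, if_pos (by omega), if_neg h0, if_neg h1]
    simp
  · rw [if_neg h2, if_neg (show ¬ s - 2 < 0 by omega), if_neg h0, if_neg h1]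
    simp

/-- The symbol of the Toeplitz determinants left after eliminating the even rows and columns. -/
def krSymbol (n : ℤ) : R :=
  oddCoeff r t (n - 1) + krX t ((r : ℤ) - 1) * altCoeff r t (n - r + 1)
    + krX t r * altCoeff r t (n - r)

/-- Eliminating the even rows and columns: the even-even block is unipotent. -/
theorem det_krFull_blocks (a : ℤ) (har : a ≤ r - 1) (k : ℕ) :
    (Matrix.fromBlocks
      (Matrix.of fun i j : Fin k => krFull r t a (2 * i) (2 * j))
      (Matrix.of fun i j : Fin k => krFull r t a (2 * i) (2 * j + 1))
      (Matrix.of fun i j : Fin k => krFull r t a (2 * i + 1) (2 * j))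
      (Matrix.of fun i j : Fin k => krFull r t a (2 * i + 1) (2 * j + 1))).det
      = toeplitzDet (krSymbol r t) k a := by
  -- `Y` is the quotient of the even-odd block by the even-even block. Since `altCoeff` vanishes at
  -- negative arguments, the products below can be computed as if the matrices were infinite.
  set Y : Matrix (Fin k) (Fin k) R := Matrix.of fun l j => altCoeff r t ((j : ℤ) - l) with hY
  have hvan : ∀ j : Fin k, ∀ n, (k : ℤ) ≤ n → altCoeff r t ((j : ℤ) - n) = 0 := by
    intro j n hn
    exact altCoeff_of_neg r t (by omega)
  have hC : (Matrix.of fun i j : Fin k => krFull r t a (2 * i) (2 * j + 1))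
      = (Matrix.of fun i j : Fin k => krFull r t a (2 * i) (2 * j)) * Y := by
    ext i j
    simp only [Matrix.of_apply, Matrix.mul_apply, hY, krFull_even, calE_even_even, calE_even_odd,
      add_mul, Finset.sum_add_distrib]
    rw [sum_ite_eq_mul_of_vanish _ (by omega) _ (fun n => altCoeff r t ((j : ℤ) - n)) (hvan j),
      sum_ite_eq_mul_of_vanish _ (by omega) _ (fun n => altCoeff r t ((j : ℤ) - n)) (hvan j)]
    have h := altCoeff_sub r t ((j : ℤ) - i)
    have h1 : (j : ℤ) - i = 0 ↔ (j : ℤ) = i := by omega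
    have h2 : (j : ℤ) - i = 1 ↔ (j : ℤ) = i + 1 := by omega
    rw [if_congr h1 rfl rfl, if_congr h2 rfl rfl] at h
    rw [← h, show (j : ℤ) - (i + 2) = j - i - 2 by ring]
    ring
  have hD : (Matrix.of fun i j : Fin k => krFull r t a (2 * i) (2 * j)).det = 1 := by
    refine leadingMinor_upper_unitriangular k (fun i j => krFull r t a (2 * i) (2 * j)) ?_ ?_
    · intro i
      rw [krFull_even, calE_even_even]
      simp
    · intro i j hij
      rw [krFull_even, calE_even_even, if_neg (by omega), if_neg (by omega), add_zero]
  rw [hC, det_fromBlocks_of_mul _ _ _ _ hD]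
  unfold toeplitzDet leadingMinor
  congr 1
  ext i j
  simp only [Matrix.sub_apply, Matrix.of_apply, Matrix.mul_apply, hY, krFull_odd_odd,
    krFull_odd_even, add_mul, Finset.sum_add_distrib]
  rw [sum_ite_eq_mul_of_vanish _ (by omega) _ (fun n => altCoeff r t ((j : ℤ) - n)) (hvan j),
    sum_ite_eq_mul_of_vanish _ (by omega) _ (fun n => altCoeff r t ((j : ℤ) - n)) (hvan j),
    krSymbol, show (j : ℤ) - i + a - 1 = a + j - i - 1 by ring,
    show (j : ℤ) - (i + r - 1 - a) = a + j - i - r + 1 by ring,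
    show (j : ℤ) - (i + r - a) = a + j - i - r by ring]
  ring

theorem leadingMinor_krFull (a : ℤ) (har : a ≤ r - 1) (k : ℕ) :
    leadingMinor (2 * k) (fun i j => krFull r t a i j) = toeplitzDet (krSymbol r t) k a := by
  rw [leadingMinor_even_odd, ← det_krFull_blocks r t a har k]
  simp only [Nat.cast_add, Nat.cast_mul, Nat.cast_ofNat, Nat.cast_one]

/-- The skew-symmetric matrix of which the matrices under the two Pfaffians are principal blocks. -/
def krSkew (i j : ℤ) : R := krFull r t (r - 2) i (j + 2)

theorem krSkew_shift (i j : ℤ) : krSkew r t (i + 2) (j + 2) = krSkew r t i j :=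
  krFull_shift r t _ _ _

/-- The coefficients are antisymmetric about `r - 2`. -/
theorem oddCoeff_neg (d : ℤ) : oddCoeff r t (r - 2 + d) = -oddCoeff r t (r - 2 - d) := by
  unfold oddCoeff
  have h1 : 2 * (r : ℤ) - 3 - (r - 2 + d) = r - 2 - d + 1 := by ring
  have h2 : 2 * (r : ℤ) - 3 - (r - 2 - d) = r - 2 + d + 1 := by ring
  rw [h1, h2]
  split_ifs <;> first | omega | simp

theorem krSkew_skew (i j : ℤ) : krSkew r t i j = -krSkew r t j i := by
  unfold krSkew
  obtain ⟨m, rfl | rfl⟩ := Int.even_or_odd' i <;> obtain ⟨n, rfl | rfl⟩ := Int.even_or_odd' j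
  · rw [show 2 * n + 2 = 2 * (n + 1) by ring, show 2 * m + 2 = 2 * (m + 1) by ring, krFull_even,
      krFull_even, calE_even_even, calE_even_even]
    split_ifs <;> first | omega | simp
  · rw [show 2 * n + 1 + 2 = 2 * (n + 1) + 1 by ring, show 2 * m + 2 = 2 * (m + 1) by ring,
      krFull_even, krFull_odd_even, calE_even_odd]
    split_ifs <;> first | omega | simp
  · rw [show 2 * n + 2 = 2 * (n + 1) by ring, show 2 * m + 1 + 2 = 2 * (m + 1) + 1 by ring,
      krFull_even, krFull_odd_even, calE_even_odd]
    split_ifs <;> first | omega | simp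
  · rw [show 2 * n + 1 + 2 = 2 * (n + 1) + 1 by ring, show 2 * m + 1 + 2 = 2 * (m + 1) + 1 by ring,
      krFull_odd_odd, krFull_odd_odd, show n + 1 - m + ((r : ℤ) - 2) - 1 = r - 2 + (n - m) by ring,
      show m + 1 - n + ((r : ℤ) - 2) - 1 = r - 2 - (n - m) by ring, oddCoeff_neg]

/-- Reading the rows `1, …, 2k` and columns `0, …, 2k - 1` of the skew-symmetric matrix in pairs
gives, up to the exchange of the two rows of each pair, the matrix `krFull` at `a = r - 1`. -/
theorem leadingMinor_krSkew_succ (k : ℕ) :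
    leadingMinor (2 * k) (fun i j => krSkew r t (1 + i) j)
      = (-1) ^ k * toeplitzDet (krSymbol r t) k (r - 1) := by
  rw [leadingMinor_even_odd, det_fromBlocks_swap_rows,
    ← det_krFull_blocks r t _ le_rfl k]
  congr 3
  · ext i j
    simp only [Matrix.of_apply, krSkew]
    push_cast
    rw [show (1 : ℤ) + (2 * i + 1) = 2 * i + 2 by ring, krFull_shift, krFull_even, krFull_even]
  · ext i j
    simp only [Matrix.of_apply, krSkew]
    push_cast
    rw [show (1 : ℤ) + (2 * i + 1) = 2 * i + 2 by ring, krFull_shift, krFull_even, krFull_even]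
  · ext i j
    simp only [Matrix.of_apply, krSkew]
    push_cast
    rw [show (1 : ℤ) + 2 * i = 2 * i + 1 by ring,
      show (2 : ℤ) * j + 2 = 2 * (j + 1) by ring, krFull_odd_even, krFull_odd_even]
    split_ifs <;> first | omega | simp
  · ext i j
    simp only [Matrix.of_apply, krSkew]
    push_cast
    rw [show (1 : ℤ) + 2 * i = 2 * i + 1 by ring,
      show (2 : ℤ) * j + 1 + 2 = 2 * (j + 1) + 1 by ring, krFull_odd_odd, krFull_odd_odd]
    congr 1
    ring

end Entries

/-! ### The solution of the Kirillov–Reshetikhin equations -/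

section Solution

variable {R : Type*} [CommRing R] (r : ℕ) (t : ℕ → R)

theorem toeplitzDet_zero (h : ℤ → R) (c : ℤ) : toeplitzDet h 0 c = 1 := leadingMinor_zero _

theorem toeplitzDet_one (h : ℤ → R) (c : ℤ) : toeplitzDet h 1 c = h c := by
  rw [toeplitzDet, leadingMinor_one]
  simp

theorem krSymbol_of_le {n : ℤ} (h0 : 0 ≤ n) (hn : n ≤ r - 2) :
    krSymbol r t n = krX t n := by
  rw [krSymbol, altCoeff_of_neg _ _ (by omega), altCoeff_of_neg _ _ (by omega), oddCoeff,
    if_pos (by omega), sub_add_cancel]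
  ring

theorem krSymbol_of_neg (hr : 3 ≤ r) {n : ℤ} (hn : n < 0) : krSymbol r t n = 0 := by
  rw [krSymbol, altCoeff_of_neg _ _ (by omega), altCoeff_of_neg _ _ (by omega), oddCoeff,
    if_neg (by omega), if_neg (by omega)]
  ring

theorem toeplitzDet_krSymbol_zero (hr : 3 ≤ r) (k : ℕ) :
    toeplitzDet (krSymbol r t) k 0 = 1 := by
  refine leadingMinor_upper_unitriangular k _ (fun i => ?_) fun i j hij => ?_
  · rw [krSymbol_of_le r t (by omega) (by omega), krX, if_pos (by omega)]
  · exact krSymbol_of_neg r t hr (by omega)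

theorem det_krMatrix (k a : ℕ) : (krMatrix r t k a).det
    = leadingMinor (2 * k - 1) fun i j => krFull r t a (1 + i) (1 + j) := by
  unfold leadingMinor
  congr 1
  ext i j
  simp only [krMatrix, zblock, Matrix.add_apply, Matrix.of_apply, krFull]
  rw [← calE_shift r t (0 + ((i : ℕ) + 1 - 2))]
  congr 2 <;> ring

/-- The first column of `krFull` on the indices `0, …, 2k - 1` is a unit vector. -/
theorem leadingMinor_krFull_succ {a : ℕ} (har : a + 2 ≤ r) {k : ℕ} (hk : 1 ≤ k) :
    leadingMinor (2 * k - 1) (fun i j => krFull r t a (1 + i) (1 + j))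
      = toeplitzDet (krSymbol r t) k a := by
  have h := leadingMinor_succ_of_column (2 * k - 1) (fun i j => krFull r t a i j)
  rw [show 2 * k - 1 + 1 = 2 * k by omega, leadingMinor_krFull r t a (by omega)] at h
  rw [h]
  · simp only [Nat.cast_add, Nat.cast_one, add_comm]
  · rw [Nat.cast_zero, show (0 : ℤ) = 2 * 0 by ring, krFull_even, calE_even_even]
    simp
  · intro i
    obtain ⟨m, hm⟩ := Nat.even_or_odd' (i + 1)
    rcases hm with hm | hm <;> rw [hm, Nat.cast_zero, show (0 : ℤ) = 2 * 0 by ring]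
    · rw [Nat.cast_mul, Nat.cast_ofNat, krFull_even, calE_even_even, if_neg (by omega),
        if_neg (by omega), add_zero]
    · rw [Nat.cast_add, Nat.cast_mul, Nat.cast_ofNat, Nat.cast_one, krFull_odd_even,
        if_neg (by omega), if_neg (by omega), add_zero]

/-- The last row of `krFull` on the indices `1, …, 2k` is a unit vector. -/
theorem leadingMinor_krFull_succ_even {a : ℕ} (har : a + 2 ≤ r) {k : ℕ} (hk : 1 ≤ k) :
    leadingMinor (2 * k) (fun i j => krFull r t a (1 + i) (1 + j))
      = toeplitzDet (krSymbol r t) k a := by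
  rw [← leadingMinor_krFull_succ r t har hk]
  have h := leadingMinor_succ_of_row (2 * k - 1) (fun i j => krFull r t a (1 + i) (1 + j))
  rw [show 2 * k - 1 + 1 = 2 * k by omega] at h
  have h1 : (1 : ℤ) + ((2 * k - 1 : ℕ) : ℤ) = 2 * k := by omega
  refine h ?_ fun j hj => ?_
  · rw [h1, krFull_even, calE_even_even]
    simp
  · rw [h1, krFull_even]
    obtain ⟨m, hm⟩ := Int.even_or_odd' (1 + (j : ℤ))
    rcases hm with hm | hm <;> rw [hm]
    · rw [calE_even_even, if_neg (by omega), if_neg (by omega), add_zero]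
    · rw [calE_even_odd, if_neg (by omega), if_neg (by omega), add_zero]

theorem krMatrixPred_apply (k : ℕ) (i j : Fin (2 * k)) :
    krMatrixPred r t k i j = windowAt (krSkew r t) 0 i j := by
  simp only [krMatrixPred, zblock, Matrix.add_apply, Matrix.of_apply, windowAt, krSkew, krFull]
  congr 2 <;> ring

theorem krMatrixLast_apply (k : ℕ) (i j : Fin (2 * k)) :
    krMatrixLast r t k i j = windowAt (krSkew r t) 1 i j := by
  simp only [krMatrixLast, zblock, Matrix.add_apply, Matrix.of_apply, windowAt, krSkew, krFull]
  rw [← calE_shift r t (0 + ((i : ℕ) + 1 - 2))]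
  congr 2 <;> ring

theorem windowAt_krSkew_add_two (s : ℤ) :
    windowAt (krSkew r t) (s + 2) = windowAt (krSkew r t) s := by
  funext i j
  rw [windowAt, windowAt, ← krSkew_shift r t (s + i)]
  congr 1 <;> ring

variable [Algebra ℚ R]

theorem krT_of_le {a : ℕ} (hr : 3 ≤ r) (har : a + 2 ≤ r) (k : ℕ) :
    krT r t k a = toeplitzDet (krSymbol r t) k a := by
  unfold krT
  by_cases hk : k = 0
  · rw [if_pos (Or.inl hk), hk, toeplitzDet_zero]
  by_cases ha : a = 0
  · rw [if_pos (Or.inr ha), ha, Nat.cast_zero, toeplitzDet_krSymbol_zero r t hr]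
  rw [if_neg (by omega), if_pos (by omega), det_krMatrix,
    leadingMinor_krFull_succ r t har (by omega)]

theorem krT_pred (hr : 3 ≤ r) (k : ℕ) :
    krT r t k (r - 1) = leadingPf k (windowAt (krSkew r t) 0) := by
  unfold krT
  by_cases hk : k = 0
  · rw [if_pos (Or.inl hk), hk, leadingPf_zero]
  rw [if_neg (by omega), if_neg (by omega), if_pos rfl, leadingPf]
  congr 1
  ext i j
  exact krMatrixPred_apply r t k i j

theorem krT_last (hr : 3 ≤ r) (k : ℕ) :
    krT r t k r = (-1) ^ k * leadingPf k (windowAt (krSkew r t) 1) := by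
  unfold krT
  by_cases hk : k = 0
  · rw [if_pos (Or.inl hk), hk, leadingPf_zero, pow_zero, one_mul]
  rw [if_neg (by omega), if_neg (by omega), if_neg (by omega), leadingPf]
  congr 2
  ext i j
  exact krMatrixLast_apply r t k i j

/-- For `k = 1` the formulas return the initial values. -/
theorem krT_one {a : ℕ} (hr : 3 ≤ r) (ha : 1 ≤ a) (har : a ≤ r) : krT r t 1 a = t a := by
  have hskew : ∀ s, ∀ i j, windowAt (krSkew r t) s i j = -windowAt (krSkew r t) s j i :=
    fun s i j => krSkew_skew r t _ _
  rcases (by omega : a + 2 ≤ r ∨ a = r - 1 ∨ a = r) with h | rfl | rfl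
  · rw [krT_of_le r t hr h, toeplitzDet_one, krSymbol_of_le r t (by omega) (by omega), krX,
      if_neg (by omega), Int.toNat_natCast]
  · rw [krT_pred r t hr, leadingPf_one _ (hskew 0), ← calE_entry_pred r hr t, windowAt, krSkew]
    have h := krFull_even r t ((r : ℤ) - 2) 0 3
    simpa using h
  · rw [krT_last a t hr, leadingPf_one _ (hskew 1), windowAt, krSkew, krFull]
    have h := calT_entry_last a hr t
    have h1 := calE_odd a t 0 4
    have e1 : (1 : ℤ) + ((1 : ℕ) : ℤ) + 2 + 2 * ((a : ℤ) - 2) - 2 = 2 * a - 2 := by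
      push_cast
      ring
    rw [e1]
    norm_num at h1 ⊢
    rw [h, h1]
    ring

variable [IsDomain R]

/-- The product `T_k^(r-1) T_k^r` continues the family of Toeplitz determinants to `a = r - 1`. -/
theorem krT_pred_mul_krT_last (hr : 3 ≤ r) (k : ℕ) :
    krT r t k (r - 1) * krT r t k r = toeplitzDet (krSymbol r t) k (r - 1) := by
  cases k with
  | zero =>
    rw [krT_pred r t hr, krT_last r t hr, leadingPf_zero, leadingPf_zero, toeplitzDet_zero]
    simp
  | succ m =>
    have h := leadingPf_windowAt_mul m (krSkew r t) (krSkew_skew r t) 0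
    simp only [zero_add] at h
    rw [leadingMinor_krSkew_succ] at h
    rw [krT_pred r t hr, krT_last r t hr, mul_left_comm, h, ← mul_assoc, ← mul_pow]
    simp

theorem isKRSolution_krT (hr : 3 ≤ r) : IsKRSolution r (krT r t) := by
  refine ⟨fun a _ _ => by simp [krT], fun k => by simp [krT], fun k hk => ?_⟩
  obtain ⟨m, rfl⟩ : ∃ m, k = m + 1 := ⟨k - 1, by omega⟩
  rw [Nat.add_sub_cancel]
  refine ⟨fun a ha har => ?_, ?_, ?_, ?_⟩
  · have h := toeplitzDet_desnanot_jacobi (krSymbol r t) m a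
    rw [krT_of_le r t hr (by omega), krT_of_le r t hr (by omega), krT_of_le r t hr (by omega),
      krT_of_le r t hr (by omega), krT_of_le r t hr (by omega), h, Nat.cast_sub ha, Nat.cast_add,
      Nat.cast_one]
  · have h := toeplitzDet_desnanot_jacobi (krSymbol r t) m ((r - 2 : ℕ) : ℤ)
    have e1 : ((r - 2 : ℕ) : ℤ) - 1 = ((r - 3 : ℕ) : ℤ) := by omega
    have e2 : ((r - 2 : ℕ) : ℤ) + 1 = r - 1 := by omega
    rw [mul_assoc, krT_pred_mul_krT_last r t hr, krT_of_le r t hr (by omega),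
      krT_of_le r t hr (by omega), krT_of_le r t hr (by omega), krT_of_le r t hr (by omega), h, e1,
      e2]
  · have h := leadingPf_windowAt_plucker m (krSkew r t) (krSkew_skew r t) 0
    have h1 : leadingMinor (2 * (m + 1)) (fun i j => krSkew r t (0 + 2 + i) (0 + j))
        = krT r t (m + 1) (r - 2) := by
      have e1 : ((r - 2 : ℕ) : ℤ) = r - 2 := by omega
      rw [krT_of_le r t hr (by omega), ← leadingMinor_krFull r t _ (by omega), e1]
      refine leadingMinor_congr fun i _ j _ => ?_
      rw [krSkew, ← krFull_shift r t _ (i : ℤ)]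
      congr 1 <;> ring
    rw [h1, windowAt_krSkew_add_two] at h
    rw [krT_pred r t hr, krT_pred r t hr, krT_pred r t hr, pow_two, h]
  · have h := leadingPf_windowAt_plucker m (krSkew r t) (krSkew_skew r t) 1
    have h1 : leadingMinor (2 * (m + 1)) (fun i j => krSkew r t (1 + 2 + i) (1 + j))
        = krT r t (m + 1) (r - 2) := by
      have e1 : ((r - 2 : ℕ) : ℤ) = r - 2 := by omega
      rw [krT_of_le r t hr (by omega), ← leadingMinor_krFull_succ_even r t (by omega) (by omega),
        e1]
      refine leadingMinor_congr fun i _ j _ => ?_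
      rw [krSkew, ← krFull_shift r t _ (1 + i : ℤ)]
      congr 1
      ring
    rw [h1, windowAt_krSkew_add_two] at h
    rw [krT_last r t hr, krT_last r t hr, krT_last r t hr, ← h]
    have hsign : (-1 : R) ^ m * (-1) ^ m = 1 := by rw [← mul_pow]; simp
    simp only [pow_succ]
    linear_combination (leadingPf (m + 1) (windowAt (krSkew r t) 1) ^ 2
      - leadingPf (m + 2) (windowAt (krSkew r t) 1) * leadingPf m (windowAt (krSkew r t) 1)) * hsign

end Solution

theorem corollary1 (r : ℕ) (hr : 3 ≤ r) (t : ℕ → ℂ) :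
    (∀ k, 1 ≤ k →
      (krMatrixPred r t k).transpose = -krMatrixPred r t k ∧
      (krMatrixLast r t k).transpose = -krMatrixLast r t k) ∧
    (∀ a, 1 ≤ a → a ≤ r → krT r t 1 a = t a) ∧
    IsKRSolution r (krT r t) := by
  refine ⟨fun k _ => ⟨?_, ?_⟩, fun a ha har => krT_one r t hr ha har, isKRSolution_krT r t hr⟩
  · ext i j
    rw [Matrix.transpose_apply, Matrix.neg_apply, krMatrixPred_apply, krMatrixPred_apply]
    exact krSkew_skew r t _ _
  · ext i j
    rw [Matrix.transpose_apply, Matrix.neg_apply, krMatrixLast_apply, krMatrixLast_apply]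
    exact krSkew_skew r t _ _
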